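/- Let $\alpha\in(0,2]$, and for a real random variable $Z$ put $\|Z\|_{\psi_\alpha}=\inf\{t>0:\mathbb E[\exp(|Z|^\alpha/t^\alpha)]\le 2\}$. There are constants $c_5,c_6,c_7,c_8>0$ depending only on $\alpha$ such that the following holds. Let $n,p\ge 1$ be integers, $\kappa>0$, $\eta\in[0,1]$, $\mu\in\mathbb R^p$, and let $U\in\mathbb R^{p\times p}$ be orthogonal. Let $P_{\mathrm{clust}}=P^{(1)}\times\cdots\times P^{(p)}$ be a product probability distribution on $\mathbb R^p$ whose marginals have mean zero and $\psi_\alpha$-norm at most $1$, with $\mathbb E_{q\sim P_{\mathrm{clust}}}\|q\|^2\ge\kappa p$. Let $\tilde P$ be the distribution of $(Uq+\tilde y\mu,\tilde y)$, where $q\sim P_{\mathrm{clust}}$ and $\tilde y\sim\mathrm{Uniform}(\{\pm1\})$ are independent, and let $P$ be a probability distribution on $\mathbb R^p\times\{\pm1\}$ that has the same marginals on $\mathbb R^p$ and on $\{\pm1\}$ as $\tilde P$ and total variation distance at most $\eta$ from $\tilde P$. Let $(x_1,y_1),\dots,(x_n,y_n)$ be independent samples from $P$ and let $X=[y_1x_1,\dots,y_nx_n]\in\mathbb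 R^{p\times n}$. Then for every $\delta>0$, with probability at least $1-\delta$, the largest singular value of $X$ satisfies $$s_1(X)\le\sqrt p\left(c_5+\frac{c_6\sqrt n}{p}\sum_{i=1}^p|\mu_i|+\frac{2n\|\mu\|^2}{p}+\frac{c_7+c_8\max_i|\mu_i|\sqrt n}{p}\Bigl(n\log 9+\log\frac4\delta\Bigr)^{2/\alpha}\right).$$ -/

import Mathlib

open MeasureTheory ProbabilityTheory
open scoped ENNReal

noncomputable section

/-- The exponential Orlicz norm `‖X‖_{ψ_α} = inf {t > 0 : E[exp(|X|^α / t^α)] ≤ 2}` of a real random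
variable `X` under `P`, as an extended nonnegative number (it is `∞` if there is no such `t`). -/
def orliczNorm {Ω : Type*} [MeasurableSpace Ω] (α : ℝ) (X : Ω → ℝ) (P : Measure Ω) : ℝ≥0∞ :=
  sInf (ENNReal.ofReal ''
    {t : ℝ | 0 < t ∧ ∫⁻ ω, ENNReal.ofReal (Real.exp (|X ω| ^ α / t ^ α)) ∂P ≤ 2})

/-- Total variation distance `sup_A |P(A) - Q(A)|` of two probability measures. -/
def totalVariationDist {E : Type*} [MeasurableSpace E] (P Q : Measure E) : ℝ :=
  ⨆ A : {A : Set E // MeasurableSet A}, |P.real A.1 - Q.real A.1|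

/-- Every set of labels is measurable. -/
instance instDiscreteMeasurableSpaceLabel : DiscreteMeasurableSpace ℤˣ where
  forall_measurableSet s :=
    ⟨Units.val '' s, MeasurableSet.of_discrete, Set.preimage_image_eq s Units.val_injective⟩

/-- The label `±1` as a real number. -/
def labelVal (y : ℤˣ) : ℝ := ((y : ℤ) : ℝ)

/-- The uniform distribution on `{±1}`. -/
def uniformLabel : Measure ℤˣ := (PMF.uniformOfFintype ℤˣ).toMeasure

/-- Admissible marginals `ν 1, …, ν p` of the product distribution `P_clust`: mean-zero probability
measures on `ℝ` with `ψ_α`-norm at most `1`, such that `E‖q‖² ≥ κ p` for `q ∼ ν 1 × ⋯ × ν p`. -/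
structure IsClusterFamily (α κ : ℝ) {p : ℕ} (ν : Fin p → Measure ℝ) : Prop where
  isProbabilityMeasure : ∀ j, IsProbabilityMeasure (ν j)
  integrable : ∀ j, Integrable (fun x : ℝ => x) (ν j)
  mean_zero : ∀ j, ∫ x, x ∂(ν j) = 0
  orlicz_le : ∀ j, orliczNorm α (fun x : ℝ => x) (ν j) ≤ 1
  second_moment : κ * p ≤ ∫ q : Fin p → ℝ, ‖(WithLp.toLp 2 q : EuclideanSpace ℝ (Fin p))‖ ^ 2
    ∂(Measure.pi ν)

/-- The clean distribution: the law of `(U q + ỹ μ, ỹ)`, where `q ∼ ν 1 × ⋯ × ν p` and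
`ỹ ∼ Uniform {±1}` are independent. -/
def cleanLaw {p : ℕ} (ν : Fin p → Measure ℝ) (U : Matrix (Fin p) (Fin p) ℝ)
    (μ : EuclideanSpace ℝ (Fin p)) : Measure (EuclideanSpace ℝ (Fin p) × ℤˣ) :=
  ((Measure.pi ν).prod uniformLabel).map
    (fun z => (WithLp.toLp 2 (U.mulVec z.1) + labelVal z.2 • μ, z.2))

/-- `P` is a noisy version of the distribution `Pc`, with noise level `η`: it is a probability
measure with the same marginals (of the input and of the label) as `Pc`, and the total variation
distance between the two is at most `η`. -/
structure IsNoisyVersion {E : Type*} [MeasurableSpace E] (η : ℝ) (Pc P : Measure (E × ℤˣ)) :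
    Prop where
  isProbabilityMeasure : IsProbabilityMeasure P
  map_fst : P.map Prod.fst = Pc.map Prod.fst
  map_snd : P.map Prod.snd = Pc.map Prod.snd
  totalVariation_le : totalVariationDist P Pc ≤ η

/-- The data matrix `[y_1 x_1, …, y_n x_n] ∈ ℝ^{p × n}`. -/
def dataMatrix {n p : ℕ} (S : Fin n → EuclideanSpace ℝ (Fin p) × ℤˣ) :
    Matrix (Fin p) (Fin n) ℝ :=
  Matrix.of fun i k => labelVal (S k).2 * (S k).1 i

/-- The largest singular value `s_1(A)` of a real matrix. Mathlib's singular values of a linear map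
between inner product spaces are listed in decreasing order, starting from the index `0`. -/
def topSingularValue {m n : ℕ} (A : Matrix (Fin m) (Fin n) ℝ) : ℝ :=
  (Matrix.toEuclideanLin A).singularValues 0

end

/-! Flipping the signs of columns is orthogonal and leaves the singular values alone, so the labels
drop out and only the law of the inputs matters, which is the clean one. For a coefficient vector
`v` in the unit ball, the combination of inputs splits into a noise part, whose norm `U` preserves,
and a multiple of `μ` of norm at most `√n ‖μ‖` by Cauchy–Schwarz. A `1/2`-net of at most `5 ^ n`
vectors reduces the problem to one fixed `v`, where `∑ j, (∑ k, v k * Q k j) ^ 2` is a sum of `p`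
independent terms.

Each term is too heavy-tailed for a direct Chernoff bound, so entries are truncated at `R` with `R ^
α = 4 (L + log p)`. A truncated entry is sub-Gaussian up to a tiny bias, with variance proxy of
order `R ^ (2 - α)` (`integral_exp_truncation_le`). An auxiliary Gaussian turns this into an
exponential moment of the squared projection at a rate `r` of order `R ^ (α - 2)`. A fourth-moment
bound sharpens it to `exp (r M)` (`lintegral_cube_exp_sq_le_exp`). Chernoff then requires a level of
order `p + R ^ (2 - α) L`, hence of order `p + L ^ (2 / α)`: the powers of `log p` are absorbed by
`p` (`rpow_mul_le_of_log`). With `L = n log 9 + log (4 / δ)` the union bound over net and entries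
closes, and AM–GM gives the stated form. -/

/-- A centered probability measure on `ℝ` with stretched exponential tails of order `α`. -/
structure IsCenteredSubWeibull (α : ℝ) (ρ : Measure ℝ) : Prop where
  isProbabilityMeasure : IsProbabilityMeasure ρ
  mean_zero : ∫ x, x ∂ρ = 0
  lintegral_exp_le : ∫⁻ x, ENNReal.ofReal (Real.exp (|x| ^ α / 4)) ∂ρ ≤ 2

/-! ### One-dimensional estimates: truncated mean and moment generating function -/

/-- The rate `1/16`, well below the available `1/4`, leaves room to multiply by further exponentials
of `|x| ^ α` while staying integrable. -/
theorem exists_one_add_pow_four_le_exp {α : ℝ} (hα : 0 < α) :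
    ∃ C : ℝ, 1 ≤ C ∧ ∀ x : ℝ, 1 + x ^ 4 ≤ C * Real.exp (|x| ^ α / 16) := by
  have hc : (0 : ℝ) < 64 / α := by positivity
  refine ⟨1 + (64 / α) ^ (4 / α), by simpa using (Real.rpow_pos_of_pos hc _).le, fun x => ?_⟩
  have h1 : 1 ≤ Real.exp (|x| ^ α / 16) := Real.one_le_exp (by positivity)
  have h2 : x ^ 4 ≤ (64 / α) ^ (4 / α) * Real.exp (|x| ^ α / 16) := by
    have h3 : |x| ^ α / (64 / α) ≤ Real.exp (|x| ^ α / (64 / α)) := by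
      linarith [Real.add_one_le_exp (|x| ^ α / (64 / α))]
    have h4 := Real.rpow_le_rpow (by positivity) h3 (show 0 ≤ 4 / α by positivity)
    rw [← Real.exp_mul, Real.div_rpow (by positivity) hc.le, ← Real.rpow_mul (abs_nonneg x),
      div_le_iff₀ (by positivity)] at h4
    have e1 : α * (4 / α) = (4 : ℕ) := by field_simp; norm_num
    have e2 : |x| ^ α / (64 / α) * (4 / α) = |x| ^ α / 16 := by field_simp; ring
    rw [e1, e2, Real.rpow_natCast, Even.pow_abs (by decide)] at h4
    linarith
  nlinarith

/-- The linear term is kept exact so that centering can be used after integration. -/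
theorem exp_le_one_add_add_sq_mul_exp_abs (y : ℝ) :
    Real.exp y ≤ 1 + y + y ^ 2 * Real.exp |y| := by
  have h : Real.exp (-y) ≥ 1 - y := by linarith [Real.add_one_le_exp (-y)]
  have hpos := Real.exp_pos y
  have hi : Real.exp (-y) * Real.exp y = 1 := by rw [← Real.exp_add]; simp
  have h2 : Real.exp y ≤ 1 + y * Real.exp y := by nlinarith
  have h4 : Real.exp y ≤ Real.exp |y| := Real.exp_le_exp.2 (le_abs_self y)
  rcases le_total 0 y with hy | hy
  · nlinarith [mul_le_mul_of_nonneg_left h2 hy, sq_nonneg y]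
  · have h5 : 1 + y ≤ Real.exp y := by linarith [Real.add_one_le_exp y]
    nlinarith [mul_le_mul_of_nonpos_left h5 hy, sq_nonneg y, Real.one_le_exp (abs_nonneg y)]

namespace IsCenteredSubWeibull

variable {α : ℝ} {ρ : Measure ℝ}

theorem integrable_exp (h : IsCenteredSubWeibull α ρ) :
    Integrable (fun x => Real.exp (|x| ^ α / 4)) ρ := by
  refine ⟨(by fun_prop : Measurable _).aestronglyMeasurable, ?_⟩
  rw [hasFiniteIntegral_iff_ofReal (Filter.Eventually.of_forall fun _ => (Real.exp_pos _).le)]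
  exact h.lintegral_exp_le.trans_lt (by simp)

theorem integral_exp_le (h : IsCenteredSubWeibull α ρ) :
    ∫ x, Real.exp (|x| ^ α / 4) ∂ρ ≤ 2 := by
  rw [integral_eq_lintegral_of_nonneg_ae (Filter.Eventually.of_forall fun _ => (Real.exp_pos _).le)
    h.integrable_exp.aestronglyMeasurable]
  simpa using ENNReal.toReal_mono (by simp) h.lintegral_exp_le

/-- A function dominated by the exponential moment is integrable, with a bounded integral. -/
theorem integrable_of_le (h : IsCenteredSubWeibull α ρ) {f : ℝ → ℝ} (hf : Measurable f) {a : ℝ}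
    (hfa : ∀ x, |f x| ≤ a * Real.exp (|x| ^ α / 4)) : Integrable f ρ :=
  (h.integrable_exp.const_mul a).mono' hf.aestronglyMeasurable (Filter.Eventually.of_forall hfa)

theorem integral_le_of_le (h : IsCenteredSubWeibull α ρ) {f : ℝ → ℝ} (hf : Measurable f) {a : ℝ}
    (ha : 0 ≤ a) (hfa : ∀ x, |f x| ≤ a * Real.exp (|x| ^ α / 4)) : ∫ x, |f x| ∂ρ ≤ 2 * a := by
  calc ∫ x, |f x| ∂ρ ≤ ∫ x, a * Real.exp (|x| ^ α / 4) ∂ρ :=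
        integral_mono (h.integrable_of_le hf hfa).abs (h.integrable_exp.const_mul a) hfa
    _ ≤ 2 * a := by
        rw [integral_const_mul]; nlinarith [h.integral_exp_le]

theorem integrable_pow_four (hα : 0 < α) (h : IsCenteredSubWeibull α ρ) :
    Integrable (fun x : ℝ => x ^ 4) ρ := by
  obtain ⟨C, hC, hCx⟩ := exists_one_add_pow_four_le_exp hα
  refine h.integrable_of_le (by fun_prop) (a := C) fun x => ?_
  rw [abs_of_nonneg (by positivity)]
  have : Real.exp (|x| ^ α / 16) ≤ Real.exp (|x| ^ α / 4) := by
    have : 0 ≤ |x| ^ α := by positivity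
    gcongr; linarith
  nlinarith [hCx x]

theorem integral_pow_four_le {C : ℝ} (hC : 0 ≤ C)
    (hCx : ∀ x : ℝ, 1 + x ^ 4 ≤ C * Real.exp (|x| ^ α / 16))
    (h : IsCenteredSubWeibull α ρ) : ∫ x, x ^ 4 ∂ρ ≤ 2 * C := by
  have e : ∀ x : ℝ, |x ^ 4| = x ^ 4 := fun x => abs_of_nonneg (by positivity)
  rw [← integral_congr_ae (Filter.Eventually.of_forall e)]
  refine h.integral_le_of_le (by fun_prop) hC fun x => ?_
  rw [e]
  have : Real.exp (|x| ^ α / 16) ≤ Real.exp (|x| ^ α / 4) := by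
    have : 0 ≤ |x| ^ α := by positivity
    gcongr; linarith
  nlinarith [hCx x]

/-- By centering, the truncated mean is minus the integral over `|x| > R`, where lowering the rate
from `1/4` to `1/16` gains at least `exp (-(R ^ α / 8))`. -/
theorem abs_integral_truncation_le {C : ℝ} (hC : 1 ≤ C)
    (hCx : ∀ x : ℝ, 1 + x ^ 4 ≤ C * Real.exp (|x| ^ α / 16))
    (hα : 0 < α) (h : IsCenteredSubWeibull α ρ) {R : ℝ} (hR : 0 ≤ R) :
    |∫ x in Set.Icc (-R) R, x ∂ρ| ≤ 2 * C * Real.exp (-(R ^ α / 8)) := by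
  have hlin : ∀ x : ℝ, |x| ≤ C * Real.exp (|x| ^ α / 16) := fun x => by
    refine le_trans ?_ (hCx x)
    have h1 : x ^ 4 = |x| ^ 4 := by rw [Even.pow_abs (by decide)]
    nlinarith [sq_nonneg (|x| ^ 2 - 1), sq_nonneg (|x| - 1), abs_nonneg x, sq_nonneg (|x|)]
  have hint : Integrable (fun x : ℝ => x) ρ := h.integrable_of_le measurable_id (a := C) fun x => by
    refine (hlin x).trans ?_
    have : 0 ≤ |x| ^ α := by positivity
    gcongr; linarith
  have hsum := integral_add_compl (μ := ρ) (measurableSet_Icc (a := -R) (b := R)) hint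
  rw [h.mean_zero] at hsum
  rw [eq_neg_of_add_eq_zero_left hsum, abs_neg, ← integral_indicator measurableSet_Icc.compl]
  refine (abs_integral_le_integral_abs).trans ?_
  rw [mul_assoc]
  refine h.integral_le_of_le (measurable_id.indicator measurableSet_Icc.compl) (by positivity)
    fun x => ?_
  by_cases hx : x ∈ (Set.Icc (-R) R)ᶜ
  · rw [Set.indicator_of_mem hx]
    have hx' : R ≤ |x| := by
      by_contra hlt
      exact hx (abs_le.1 (not_le.1 hlt).le)
    refine (hlin x).trans ?_
    rw [mul_assoc, ← Real.exp_add]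
    have : R ^ α ≤ |x| ^ α := Real.rpow_le_rpow hR hx' hα.le
    have : 0 ≤ |x| ^ α := by positivity
    gcongr; linarith
  · rw [Set.indicator_of_notMem hx]; simp; positivity

/-- On `|x| ≤ R` one has `x ^ 2 ≤ R ^ (2 - α) * |x| ^ α`, so AM–GM bounds `|u * x|` by a multiple of
`u ^ 2 * R ^ (2 - α)` plus a small part of `|x| ^ α` that the tail absorbs. The term free of `u` is
the cost of the bias of truncation. -/
theorem integral_exp_truncation_le {C : ℝ} (hC : 1 ≤ C)
    (hCx : ∀ x : ℝ, 1 + x ^ 4 ≤ C * Real.exp (|x| ^ α / 16))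
    (hα : 0 < α) (hα2 : α ≤ 2) (h : IsCenteredSubWeibull α ρ)
    {R : ℝ} (hR : 1 ≤ R) (u : ℝ) :
    ∫ x in Set.Icc (-R) R, Real.exp (u * x) ∂ρ ≤
      Real.exp (2 * C ^ 2 * Real.exp (-(R ^ α / 4)) + 8 * C * R ^ (2 - α) * u ^ 2) := by
  have := h.isProbabilityMeasure
  set D := R ^ (2 - α) with hD
  have hD1 : 1 ≤ D := Real.one_le_rpow hR (by linarith)
  have hquad : ∀ x ∈ Set.Icc (-R) R, |u * x| ≤ 4 * u ^ 2 * D + |x| ^ α / 16 := fun x hx => by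
    have hxR : |x| ≤ R := abs_le.2 hx
    have h1 : |x| ^ 2 ≤ |x| ^ α * D := by
      have e : |x| ^ 2 = |x| ^ α * |x| ^ (2 - α) := by
        rw [← Real.rpow_add_of_nonneg (abs_nonneg x) hα.le (by linarith)]
        rw [← Real.rpow_natCast]; norm_num
      rw [e, hD]
      gcongr
    rw [abs_mul]
    have h0 : 0 ≤ |x| ^ α := by positivity
    have h2 : (|u| * |x|) ^ 2 ≤ (4 * u ^ 2 * D + |x| ^ α / 16) ^ 2 := by
      have := mul_le_mul_of_nonneg_left h1 (sq_nonneg u)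
      rw [mul_pow, sq_abs u]
      nlinarith [sq_nonneg (4 * u ^ 2 * D - |x| ^ α / 16)]
    exact le_of_sq_le_sq h2 (by positivity)
  have hsq : ∀ x : ℝ, x ^ 2 ≤ C * Real.exp (|x| ^ α / 16) := fun x => by
    nlinarith [hCx x, sq_nonneg (x ^ 2 - 1), sq_nonneg x]
  set g : ℝ → ℝ := (Set.Icc (-R) R).indicator fun x => x ^ 2 * Real.exp |u * x| with hg
  have hgm : Measurable g := (by fun_prop : Measurable _).indicator measurableSet_Icc
  have hg0 : ∀ x, 0 ≤ g x := fun x => Set.indicator_nonneg (fun _ _ => by positivity) x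
  have hgb : ∀ x, |g x| ≤ C * Real.exp (4 * u ^ 2 * D) * Real.exp (|x| ^ α / 4) := fun x => by
    rw [abs_of_nonneg (hg0 x)]
    by_cases hx : x ∈ Set.Icc (-R) R
    · rw [hg, Set.indicator_of_mem hx]
      calc x ^ 2 * Real.exp |u * x|
          ≤ (C * Real.exp (|x| ^ α / 16)) * Real.exp (4 * u ^ 2 * D + |x| ^ α / 16) := by
            gcongr
            · exact hsq x
            · exact hquad x hx
        _ = C * Real.exp (4 * u ^ 2 * D) * Real.exp (|x| ^ α / 8) := by
            rw [mul_assoc C, mul_assoc C, ← Real.exp_add, ← Real.exp_add]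
            congr 2
            ring
        _ ≤ _ := by
            have : 0 ≤ |x| ^ α := by positivity
            gcongr; linarith
    · rw [hg, Set.indicator_of_notMem hx]; positivity
  have hgint := h.integrable_of_le hgm hgb
  have hgI : ∫ x, g x ∂ρ ≤ 2 * (C * Real.exp (4 * u ^ 2 * D)) := by
    have := h.integral_le_of_le hgm (by positivity) hgb
    simpa only [abs_of_nonneg (hg0 _)] using this
  have hgset : ∫ x in Set.Icc (-R) R, x ^ 2 * Real.exp |u * x| ∂ρ = ∫ x, g x ∂ρ :=
    (integral_indicator measurableSet_Icc).symm
  have hc : ∀ {f : ℝ → ℝ}, Continuous f → IntegrableOn f (Set.Icc (-R) R) ρ := fun hf =>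
    hf.continuousOn.integrableOn_compact isCompact_Icc
  have hm := h.abs_integral_truncation_le hC hCx hα (by linarith : 0 ≤ R)
  set m := 2 * C * Real.exp (-(R ^ α / 8)) with hmdef
  have hmsq : m ^ 2 / 2 = 2 * C ^ 2 * Real.exp (-(R ^ α / 4)) := by
    rw [hmdef, mul_pow, ← Real.exp_nat_mul]
    push_cast
    ring_nf
  have key : ∫ x in Set.Icc (-R) R, Real.exp (u * x) ∂ρ ≤
      1 + |u| * m + u ^ 2 * (2 * (C * Real.exp (4 * u ^ 2 * D))) := by
    calc ∫ x in Set.Icc (-R) R, Real.exp (u * x) ∂ρ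
        ≤ ∫ x in Set.Icc (-R) R, (1 + u * x + u ^ 2 * (x ^ 2 * Real.exp |u * x|)) ∂ρ := by
          refine integral_mono (hc (by fun_prop)) (hc (by fun_prop)) fun x => ?_
          have := exp_le_one_add_add_sq_mul_exp_abs (u * x)
          rw [mul_pow, mul_assoc] at this
          exact this
      _ = ρ.real (Set.Icc (-R) R) + u * (∫ x in Set.Icc (-R) R, x ∂ρ) + u ^ 2 * ∫ x, g x ∂ρ := by
          rw [integral_add (hc (by fun_prop)) (hc (by fun_prop)),
            integral_add (hc (by fun_prop)) (hc (by fun_prop)), integral_const_mul,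
            integral_const_mul, hgset]
          simp
      _ ≤ _ := by
          refine add_le_add (add_le_add measureReal_le_one ?_) (by gcongr)
          refine (le_abs_self _).trans ?_
          rw [abs_mul]
          gcongr
  refine key.trans ?_
  rw [← hmsq]
  have hm0 : 0 ≤ m := by positivity
  -- The bias enters linearly in `u`; AM–GM splits it into a part quadratic in `u` and the constant
  -- `m ^ 2 / 2`.
  have ha : |u| * m ≤ u ^ 2 / 2 + m ^ 2 / 2 := by
    nlinarith [sq_nonneg (|u| - m), sq_abs u]
  have hE : 1 ≤ Real.exp (4 * u ^ 2 * D) := Real.one_le_exp (by positivity)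
  have hCD : 1 / 2 + 2 * C + 4 * D ≤ 8 * C * D := by
    nlinarith [mul_nonneg (sub_nonneg.2 hC) (sub_nonneg.2 hD1)]
  calc 1 + |u| * m + u ^ 2 * (2 * (C * Real.exp (4 * u ^ 2 * D)))
      ≤ (|u| * m + 2 * C * u ^ 2 + 1) * Real.exp (4 * u ^ 2 * D) := by
        have : 0 ≤ |u| * m := by positivity
        nlinarith
    _ ≤ Real.exp (|u| * m + 2 * C * u ^ 2) * Real.exp (4 * u ^ 2 * D) := by
        gcongr; exact Real.add_one_le_exp _
    _ ≤ _ := by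
        rw [← Real.exp_add]
        refine Real.exp_le_exp.2 ?_
        nlinarith [mul_le_mul_of_nonneg_left hCD (sq_nonneg u)]

theorem lintegral_exp_truncation_le {C : ℝ} (hC : 1 ≤ C)
    (hCx : ∀ x : ℝ, 1 + x ^ 4 ≤ C * Real.exp (|x| ^ α / 16))
    (hα : 0 < α) (hα2 : α ≤ 2) (h : IsCenteredSubWeibull α ρ)
    {R : ℝ} (hR : 1 ≤ R) (u : ℝ) :
    ∫⁻ x, (Set.Icc (-R) R).indicator (fun x => ENNReal.ofReal (Real.exp (u * x))) x ∂ρ ≤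
      ENNReal.ofReal
        (Real.exp (2 * C ^ 2 * Real.exp (-(R ^ α / 4)) + 8 * C * R ^ (2 - α) * u ^ 2)) := by
  have := h.isProbabilityMeasure
  rw [lintegral_indicator measurableSet_Icc, ← ofReal_integral_eq_lintegral_ofReal
    ((by fun_prop : Continuous fun x => Real.exp (u * x)).continuousOn.integrableOn_compact
      isCompact_Icc) (Filter.Eventually.of_forall fun _ => (Real.exp_pos _).le)]
  exact ENNReal.ofReal_le_ofReal (h.integral_exp_truncation_le hC hCx hα hα2 hR u)

theorem measure_compl_Icc_le (hα : 0 < α) (h : IsCenteredSubWeibull α ρ) {R : ℝ} (hR : 0 ≤ R) :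
    ρ (Set.Icc (-R) R)ᶜ ≤ ENNReal.ofReal (2 * Real.exp (-(R ^ α / 4))) := by
  have h1 : ENNReal.ofReal (Real.exp (R ^ α / 4)) * ρ (Set.Icc (-R) R)ᶜ ≤ 2 := by
    refine le_trans ?_ h.lintegral_exp_le
    refine le_trans ?_ (mul_meas_ge_le_lintegral (by fun_prop)
      (ENNReal.ofReal (Real.exp (R ^ α / 4))))
    gcongr
    intro x hx
    have hx' : R ≤ |x| := by
      by_contra hlt
      exact hx (abs_le.1 (not_le.1 hlt).le)
    have : R ^ α ≤ |x| ^ α := Real.rpow_le_rpow hR hx' hα.le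
    simp only [Set.mem_ofPred_eq]
    gcongr
  have h2 : ENNReal.ofReal (Real.exp (R ^ α / 4)) *
      ENNReal.ofReal (2 * Real.exp (-(R ^ α / 4))) = 2 := by
    rw [← ENNReal.ofReal_mul (Real.exp_pos _).le, mul_left_comm, ← Real.exp_add]; simp
  rw [← h2] at h1
  exact (ENNReal.mul_le_mul_iff_right (by simp [Real.exp_pos]) (by simp)).1 h1

end IsCenteredSubWeibull

/-! ### Fourth moments of independent sums -/

section FourthMoment

variable {Ω : Type*} [MeasurableSpace Ω] {P : Measure Ω} [IsProbabilityMeasure P]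

theorem integrable_pow_of_integrable_pow_four {X : Ω → ℝ} (hX : Measurable X)
    (h : Integrable (fun ω => X ω ^ 4) P) {m : ℕ} (hm : m ≤ 4) :
    Integrable (fun ω => X ω ^ m) P := by
  refine ((integrable_const (1 : ℝ)).add h).mono' (hX.pow_const m).aestronglyMeasurable
    (Filter.Eventually.of_forall fun ω => ?_)
  have h4 : X ω ^ 4 = |X ω| ^ 4 := by rw [Even.pow_abs (by decide)]
  simp only [Pi.add_apply, Real.norm_eq_abs, abs_pow, h4]
  rcases le_total 1 |X ω| with h1 | h1
  · linarith [pow_le_pow_right₀ h1 hm]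
  · linarith [pow_le_one₀ (n := m) (abs_nonneg (X ω)) h1, pow_nonneg (abs_nonneg (X ω)) 4]

theorem sq_integral_sq_le_integral_pow_four {X : Ω → ℝ} (hX : Measurable X)
    (h : Integrable (fun ω => X ω ^ 4) P) :
    (∫ ω, X ω ^ 2 ∂P) ^ 2 ≤ ∫ ω, X ω ^ 4 ∂P := by
  set c := ∫ ω, X ω ^ 2 ∂P with hc
  have h2 := integrable_pow_of_integrable_pow_four hX h (m := 2) (by norm_num)
  have h0 : 0 ≤ ∫ ω, (X ω ^ 2 - c) ^ 2 ∂P := integral_nonneg fun _ => sq_nonneg _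
  have e : ∀ ω, (X ω ^ 2 - c) ^ 2 = X ω ^ 4 - 2 * c * X ω ^ 2 + c ^ 2 := fun ω => by ring
  simp_rw [e] at h0
  rw [integral_add (by exact h.sub (h2.const_mul _)) (integrable_const _),
    integral_sub h (h2.const_mul _), integral_const_mul, ← hc] at h0
  simp only [integral_const, probReal_univ, one_smul] at h0
  linarith

theorem ProbabilityTheory.IndepFun.integrable_pow_mul_pow {X Y : Ω → ℝ} (hXY : IndepFun X Y P)
    (hX : Measurable X) (hY : Measurable Y) (hX4 : Integrable (fun ω => X ω ^ 4) P)
    (hY4 : Integrable (fun ω => Y ω ^ 4) P) {a b : ℕ} (ha : a ≤ 4) (hb : b ≤ 4) :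
    Integrable (fun ω => X ω ^ a * Y ω ^ b) P :=
  (hXY.comp (φ := fun x => x ^ a) (ψ := fun x => x ^ b) (by fun_prop) (by fun_prop)).integrable_mul
    (integrable_pow_of_integrable_pow_four hX hX4 ha)
    (integrable_pow_of_integrable_pow_four hY hY4 hb)

theorem ProbabilityTheory.IndepFun.integrable_add_pow_four {X Y : Ω → ℝ} (hXY : IndepFun X Y P)
    (hX : Measurable X) (hY : Measurable Y) (hX4 : Integrable (fun ω => X ω ^ 4) P)
    (hY4 : Integrable (fun ω => Y ω ^ 4) P) : Integrable (fun ω => (X ω + Y ω) ^ 4) P := by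
  have e : (fun ω => (X ω + Y ω) ^ 4) = fun ω => X ω ^ 4 + 4 * (X ω ^ 3 * Y ω ^ 1) +
      6 * (X ω ^ 2 * Y ω ^ 2) + 4 * (X ω ^ 1 * Y ω ^ 3) + Y ω ^ 4 := by
    funext ω; ring
  have I := fun a b ha hb => hXY.integrable_pow_mul_pow hX hY hX4 hY4 (a := a) (b := b) ha hb
  rw [e]
  exact (((hX4.add ((I 3 1 (by norm_num) (by norm_num)).const_mul _)).add
    ((I 2 2 (by norm_num) (by norm_num)).const_mul _)).add
    ((I 1 3 (by norm_num) (by norm_num)).const_mul _)).add hY4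

theorem ProbabilityTheory.IndepFun.integral_add_pow_four {X Y : Ω → ℝ} (hXY : IndepFun X Y P)
    (hX : Measurable X) (hY : Measurable Y) (hX4 : Integrable (fun ω => X ω ^ 4) P)
    (hY4 : Integrable (fun ω => Y ω ^ 4) P) (hX0 : ∫ ω, X ω ∂P = 0) (hY0 : ∫ ω, Y ω ∂P = 0) :
    ∫ ω, (X ω + Y ω) ^ 4 ∂P =
      ∫ ω, X ω ^ 4 ∂P + 6 * ((∫ ω, X ω ^ 2 ∂P) * ∫ ω, Y ω ^ 2 ∂P) + ∫ ω, Y ω ^ 4 ∂P := by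
  have e : ∀ ω, (X ω + Y ω) ^ 4 = X ω ^ 4 + 4 * (X ω ^ 3 * Y ω ^ 1) +
      6 * (X ω ^ 2 * Y ω ^ 2) + 4 * (X ω ^ 1 * Y ω ^ 3) + Y ω ^ 4 := fun ω => by ring
  have I := fun a b ha hb => hXY.integrable_pow_mul_pow hX hY hX4 hY4 (a := a) (b := b) ha hb
  have E : ∀ a b : ℕ, ∫ ω, X ω ^ a * Y ω ^ b ∂P = (∫ ω, X ω ^ a ∂P) * ∫ ω, Y ω ^ b ∂P :=
    fun a b => hXY.integral_fun_comp_mul_comp (f := fun x => x ^ a) (g := fun x => x ^ b)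
      hX.aemeasurable hY.aemeasurable (by fun_prop) (by fun_prop)
  have i31 := (I 3 1 (by norm_num) (by norm_num)).const_mul 4
  have i22 := (I 2 2 (by norm_num) (by norm_num)).const_mul 6
  have i13 := (I 1 3 (by norm_num) (by norm_num)).const_mul 4
  simp_rw [e]
  rw [integral_add (by exact ((hX4.add i31).add i22).add i13) hY4,
    integral_add (by exact (hX4.add i31).add i22) i13, integral_add (by exact hX4.add i31) i22,
    integral_add hX4 i31, integral_const_mul, integral_const_mul, integral_const_mul, E, E, E]
  simp [hX0, hY0]

theorem integral_add_sq_of_indepFun {X Y : Ω → ℝ} (hXY : IndepFun X Y P)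
    (hX : Measurable X) (hY : Measurable Y) (hX4 : Integrable (fun ω => X ω ^ 4) P)
    (hY4 : Integrable (fun ω => Y ω ^ 4) P) (hX0 : ∫ ω, X ω ∂P = 0) :
    ∫ ω, (X ω + Y ω) ^ 2 ∂P = ∫ ω, X ω ^ 2 ∂P + ∫ ω, Y ω ^ 2 ∂P := by
  have e : ∀ ω, (X ω + Y ω) ^ 2 = X ω ^ 2 + 2 * (X ω ^ 1 * Y ω ^ 1) + Y ω ^ 2 := fun ω => by ring
  have i11 := (hXY.integrable_pow_mul_pow hX hY hX4 hY4 (a := 1) (b := 1) (by norm_num)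
    (by norm_num)).const_mul 2
  have iX := integrable_pow_of_integrable_pow_four hX hX4 (m := 2) (by norm_num)
  have iY := integrable_pow_of_integrable_pow_four hY hY4 (m := 2) (by norm_num)
  simp_rw [e]
  rw [integral_add (by exact iX.add i11) iY, integral_add iX i11, integral_const_mul,
    hXY.integral_fun_comp_mul_comp (f := fun x => x ^ 1) (g := fun x => x ^ 1)
      hX.aemeasurable hY.aemeasurable (by fun_prop) (by fun_prop)]
  simp [hX0]

/-- Fourth moments of sums of independent centered random variables. -/
theorem integral_sum_pow_four_le {ι : Type*} {X : ι → Ω → ℝ} (hX : iIndepFun X P)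
    (hXm : ∀ i, Measurable (X i)) (hX4 : ∀ i, Integrable (fun ω => X i ω ^ 4) P)
    (hX0 : ∀ i, ∫ ω, X i ω ∂P = 0) {a : ι → ℝ} (ha : ∀ i, 0 ≤ a i)
    (hXa : ∀ i, ∫ ω, X i ω ^ 4 ∂P ≤ a i ^ 2) (s : Finset ι) :
    Integrable (fun ω => (∑ i ∈ s, X i ω) ^ 4) P ∧
      ∫ ω, (∑ i ∈ s, X i ω) ^ 4 ∂P ≤ 3 * (∑ i ∈ s, a i) ^ 2 := by
  classical
  -- The induction must also carry centering and the second moment: the cross term `6 E[S²] E[X²]`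
  -- is at most the cross term of `3 (∑ a + a i) ^ 2`.
  suffices h : Integrable (fun ω => (∑ i ∈ s, X i ω) ^ 4) P ∧ ∫ ω, ∑ i ∈ s, X i ω ∂P = 0 ∧
      ∫ ω, (∑ i ∈ s, X i ω) ^ 2 ∂P ≤ ∑ i ∈ s, a i ∧
      ∫ ω, (∑ i ∈ s, X i ω) ^ 4 ∂P ≤ 3 * (∑ i ∈ s, a i) ^ 2 from ⟨h.1, h.2.2.2⟩
  induction s using Finset.induction_on with
  | empty => simp
  | insert i s hi ih =>
    obtain ⟨h4, h0, h2, hb⟩ := ih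
    have hS : Measurable fun ω => ∑ j ∈ s, X j ω := Finset.measurable_sum _ fun j _ => hXm j
    have hind : IndepFun (fun ω => ∑ j ∈ s, X j ω) (X i) P := by
      have := hX.indepFun_finsetSum_of_notMem hXm hi
      rwa [show (∑ j ∈ s, X j) = fun ω => ∑ j ∈ s, X j ω by ext; simp] at this
    have hi2 : ∫ ω, X i ω ^ 2 ∂P ≤ a i := by
      refine le_of_sq_le_sq ?_ (ha i)
      exact (sq_integral_sq_le_integral_pow_four (hXm i) (hX4 i)).trans (hXa i)
    have hi0 : 0 ≤ ∫ ω, X i ω ^ 2 ∂P := integral_nonneg fun _ => sq_nonneg _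
    have hs0 : 0 ≤ ∑ j ∈ s, a j := Finset.sum_nonneg fun j _ => ha j
    have i1 : ∀ {Y : Ω → ℝ}, Measurable Y → Integrable (fun ω => Y ω ^ 4) P → Integrable Y P :=
      fun hY h => by simpa using integrable_pow_of_integrable_pow_four hY h (m := 1) (by norm_num)
    simp only [Finset.sum_insert hi, add_comm (X i _), add_comm (a i)]
    refine ⟨hind.integrable_add_pow_four hS (hXm i) h4 (hX4 i), ?_, ?_, ?_⟩
    · rw [integral_add (i1 hS h4) (i1 (hXm i) (hX4 i)), h0, hX0, add_zero]
    · rw [integral_add_sq_of_indepFun hind hS (hXm i) h4 (hX4 i) h0]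
      exact add_le_add h2 hi2
    · rw [hind.integral_add_pow_four hS (hXm i) h4 (hX4 i) h0 (hX0 i)]
      nlinarith [mul_le_mul h2 hi2 hi0 hs0, hXa i, sq_nonneg (a i)]

end FourthMoment

/-! ### Product measures and Gaussian integrals -/

theorem lintegral_pi_prod {ι : Type*} [Fintype ι] {E : ι → Type*} [∀ i, MeasurableSpace (E i)]
    (ρ : ∀ i, Measure (E i)) [∀ i, IsProbabilityMeasure (ρ i)] {f : ∀ i, E i → ℝ≥0∞}
    (hf : ∀ i, Measurable (f i)) :
    ∫⁻ x, ∏ i, f i (x i) ∂Measure.pi ρ = ∏ i, ∫⁻ x, f i x ∂ρ i := by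
  rw [lintegral_prod_eq_prod_lintegral_of_indepFun Finset.univ (fun i (x : ∀ i, E i) => f i (x i))
    (iIndepFun_pi fun i => (hf i).aemeasurable) fun i => (hf i).comp (measurable_pi_apply i)]
  exact Finset.prod_congr rfl fun i _ => (measurePreserving_eval ρ i).lintegral_comp (hf i)

/-- Transposing a matrix with independent entries. -/
theorem pi_pi_map_flip {ι κ : Type*} [Fintype ι] [Fintype κ] {E : κ → Type*}
    [∀ j, MeasurableSpace (E j)] (ρ : ∀ j, Measure (E j)) [∀ j, IsProbabilityMeasure (ρ j)] :
    (Measure.pi fun _ : ι => Measure.pi ρ).map (fun Q j k => Q k j) =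
      Measure.pi fun j => Measure.pi fun _ : ι => ρ j := by
  symm
  -- Two-level rectangles suffice, since each column σ-algebra is itself generated by rectangles; on
  -- them both sides are the same double product.
  refine Measure.pi_eq_generateFrom
    (C := fun j =>
      Set.pi Set.univ '' Set.pi Set.univ fun _ : ι => {s : Set (E j) | MeasurableSet s})
    (fun j => generateFrom_pi) (fun j => isPiSystem_pi)
    (fun j => ⟨fun _ => Set.univ, fun _ => ⟨fun _ => Set.univ, by simp, by simp⟩, by simp,
      Set.iUnion_const _⟩) fun s hs => ?_
  choose t ht hts using hs
  have hts' : s = fun j => Set.pi Set.univ (t j) := funext fun j => (hts j).symm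
  subst hts'
  have htm : ∀ j k, MeasurableSet (t j k) := fun j k => ht j k (Set.mem_univ k)
  rw [Measure.map_apply (by fun_prop)
    (MeasurableSet.univ_pi fun j => MeasurableSet.univ_pi fun k => htm j k)]
  have e : (fun (Q : ι → ∀ j, E j) j k => Q k j) ⁻¹'
      Set.pi Set.univ (fun j => Set.pi Set.univ (t j)) =
      Set.pi Set.univ fun k => Set.pi Set.univ fun j => t j k := by
    ext Q; simp only [Set.mem_preimage, Set.mem_univ_pi]; exact forall_comm
  rw [e]
  simp_rw [Measure.pi_pi]
  exact Finset.prod_comm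

theorem lintegral_exp_mul_gaussianReal (s : ℝ) :
    ∫⁻ g, ENNReal.ofReal (Real.exp (s * g)) ∂gaussianReal 0 1 =
      ENNReal.ofReal (Real.exp (s ^ 2 / 2)) := by
  rw [← ofReal_integral_eq_lintegral_ofReal (integrable_exp_mul_gaussianReal s)
    (Filter.Eventually.of_forall fun _ => (Real.exp_pos _).le)]
  have := congrFun (mgf_id_gaussianReal (μ := 0) (v := 1)) s
  simp only [mgf, id, zero_mul, zero_add, NNReal.coe_one, one_mul] at this
  rw [this]

theorem lintegral_exp_sq_div_four_gaussianReal_le :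
    ∫⁻ g, ENNReal.ofReal (Real.exp (g ^ 2 / 4)) ∂gaussianReal 0 1 ≤ 2 := by
  rw [gaussianReal_of_var_ne_zero 0 one_ne_zero,
    lintegral_withDensity_eq_lintegral_mul _ (measurable_gaussianPDF 0 1) (by fun_prop)]
  have e : ∀ g : ℝ, (gaussianPDF 0 1 * fun g => ENNReal.ofReal (Real.exp (g ^ 2 / 4))) g =
      ENNReal.ofReal ((Real.sqrt (2 * Real.pi))⁻¹ * Real.exp (-(1 / 4) * g ^ 2)) := fun g => by
    rw [Pi.mul_apply, gaussianPDF, ← ENNReal.ofReal_mul (gaussianPDFReal_nonneg _ _ _),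
      gaussianPDFReal, mul_assoc, ← Real.exp_add]
    simp only [NNReal.coe_one, mul_one, sub_zero]
    ring_nf
  simp_rw [e]
  rw [← ofReal_integral_eq_lintegral_ofReal ((integrable_exp_neg_mul_sq (by norm_num)).const_mul _)
    (Filter.Eventually.of_forall fun _ => by positivity), integral_const_mul, integral_gaussian]
  have : (Real.sqrt (2 * Real.pi))⁻¹ * Real.sqrt (Real.pi / (1 / 4)) ≤ 2 := by
    rw [inv_mul_le_iff₀ (by positivity)]
    refine Real.sqrt_le_iff.2 ⟨by positivity, ?_⟩
    rw [mul_pow, Real.sq_sqrt (by positivity)]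
    nlinarith [Real.pi_pos]
  simpa using ENNReal.ofReal_le_ofReal this

/-! ### Exponential moments of truncated projections -/

/-- The cube of sup-norm radius `R`. -/
def cube (ι : Type*) (R : ℝ) : Set (ι → ℝ) := Set.pi Set.univ fun _ => Set.Icc (-R) R

theorem measurableSet_cube {ι : Type*} [Finite ι] (R : ℝ) : MeasurableSet (cube ι R) := by
  have := Fintype.ofFinite ι
  exact MeasurableSet.univ_pi fun _ => measurableSet_Icc

theorem cube_indicator_exp_sum {ι : Type*} [Fintype ι] (R : ℝ) (v x : ι → ℝ) (s : ℝ) :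
    (cube ι R).indicator (fun x => ENNReal.ofReal (Real.exp (s * ∑ k, v k * x k))) x =
      ∏ k, (Set.Icc (-R) R).indicator
        (fun y => ENNReal.ofReal (Real.exp (s * v k * y))) (x k) := by
  by_cases hx : x ∈ cube ι R
  · have hx' : ∀ k, x k ∈ Set.Icc (-R) R := fun k => hx k (Set.mem_univ k)
    rw [Set.indicator_of_mem hx]
    simp_rw [Set.indicator_of_mem (hx' _)]
    rw [← ENNReal.ofReal_prod_of_nonneg fun _ _ => (Real.exp_pos _).le, ← Real.exp_sum,
      Finset.mul_sum]
    simp_rw [mul_assoc]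
  · rw [Set.indicator_of_notMem hx]
    simp only [cube, Set.mem_univ_pi, not_forall] at hx
    obtain ⟨k, hk⟩ := hx
    exact (Finset.prod_eq_zero (Finset.mem_univ k) (Set.indicator_of_notMem hk _)).symm

namespace IsCenteredSubWeibull

variable {α : ℝ} {ρ : Measure ℝ} {ι : Type*} [Fintype ι]

/-- The cube indicator factorizes over coordinates. The hypothesis `hcard` keeps the accumulated
bias below `2 * C ^ 2`, whatever the dimension. -/
theorem lintegral_cube_exp_le {C : ℝ} (hC : 1 ≤ C)
    (hCx : ∀ x : ℝ, 1 + x ^ 4 ≤ C * Real.exp (|x| ^ α / 16)) (hα : 0 < α) (hα2 : α ≤ 2)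
    (h : IsCenteredSubWeibull α ρ) {R : ℝ} (hR : 1 ≤ R)
    (hcard : Fintype.card ι * Real.exp (-(R ^ α / 4)) ≤ 1) {v : ι → ℝ} (hv : ∑ k, v k ^ 2 ≤ 1)
    (s : ℝ) :
    ∫⁻ x, (cube ι R).indicator (fun x => ENNReal.ofReal (Real.exp (s * ∑ k, v k * x k))) x
        ∂Measure.pi (fun _ : ι => ρ) ≤
      ENNReal.ofReal (Real.exp (2 * C ^ 2 + 8 * C * R ^ (2 - α) * s ^ 2)) := by
  have := h.isProbabilityMeasure
  simp_rw [cube_indicator_exp_sum]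
  rw [lintegral_pi_prod (fun _ : ι => ρ) fun k =>
    Measurable.indicator (by fun_prop) measurableSet_Icc]
  refine (Finset.prod_le_prod' fun k _ =>
    h.lintegral_exp_truncation_le hC hCx hα hα2 hR (s * v k)).trans ?_
  rw [← ENNReal.ofReal_prod_of_nonneg fun _ _ => (Real.exp_pos _).le, ← Real.exp_sum]
  refine ENNReal.ofReal_le_ofReal (Real.exp_le_exp.2 ?_)
  have hR0 : 0 ≤ R ^ (2 - α) := by positivity
  rw [Finset.sum_add_distrib, Finset.sum_const, Finset.card_univ, nsmul_eq_mul, ← Finset.mul_sum]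
  simp_rw [mul_pow]
  rw [← Finset.mul_sum]
  have h1 : s ^ 2 * ∑ k, v k ^ 2 ≤ s ^ 2 := mul_le_of_le_one_right (sq_nonneg s) hv
  have h2 := mul_le_mul_of_nonneg_left h1 (show 0 ≤ 8 * C * R ^ (2 - α) by positivity)
  nlinarith [mul_le_mul_of_nonneg_left hcard (show 0 ≤ 2 * C ^ 2 by positivity)]

/-- Linearization of the square in the exponent by an independent Gaussian. -/
theorem lintegral_cube_exp_sq_le {C : ℝ} (hC : 1 ≤ C)
    (hCx : ∀ x : ℝ, 1 + x ^ 4 ≤ C * Real.exp (|x| ^ α / 16)) (hα : 0 < α) (hα2 : α ≤ 2)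
    (h : IsCenteredSubWeibull α ρ) {R : ℝ} (hR : 1 ≤ R)
    (hcard : Fintype.card ι * Real.exp (-(R ^ α / 4)) ≤ 1) {v : ι → ℝ} (hv : ∑ k, v k ^ 2 ≤ 1)
    {r : ℝ} (hr : 0 ≤ r) (hr' : 128 * C * R ^ (2 - α) * r ≤ 1) :
    ∫⁻ x, (cube ι R).indicator
        (fun x => ENNReal.ofReal (Real.exp (2 * (r * (∑ k, v k * x k) ^ 2)))) x
        ∂Measure.pi (fun _ : ι => ρ) ≤ ENNReal.ofReal (2 * Real.exp (2 * C ^ 2)) := by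
  have := h.isProbabilityMeasure
  set γ := gaussianReal 0 1
  have e : ∀ x : ι → ℝ, (cube ι R).indicator
      (fun x => ENNReal.ofReal (Real.exp (2 * (r * (∑ k, v k * x k) ^ 2)))) x =
      ∫⁻ g, (cube ι R).indicator (fun x => ENNReal.ofReal
        (Real.exp ((2 * Real.sqrt r * g) * ∑ k, v k * x k))) x ∂γ := fun x => by
    by_cases hx : x ∈ cube ι R
    · simp_rw [Set.indicator_of_mem hx]
      have e1 : ∀ g, 2 * Real.sqrt r * g * ∑ k, v k * x k =
        (2 * Real.sqrt r * ∑ k, v k * x k) * g := fun g => by ring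
      simp_rw [e1]
      rw [lintegral_exp_mul_gaussianReal, mul_pow, mul_pow, Real.sq_sqrt hr]
      ring_nf
    · simp_rw [Set.indicator_of_notMem hx]; simp
  simp_rw [e]
  rw [lintegral_lintegral_swap]
  · calc ∫⁻ g, ∫⁻ x, (cube ι R).indicator (fun x => ENNReal.ofReal
            (Real.exp ((2 * Real.sqrt r * g) * ∑ k, v k * x k))) x ∂Measure.pi (fun _ : ι => ρ) ∂γ
        ≤ ∫⁻ g, ENNReal.ofReal (Real.exp (2 * C ^ 2)) *
            ENNReal.ofReal (Real.exp (g ^ 2 / 4)) ∂γ := by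
          refine lintegral_mono fun g => ?_
          refine (h.lintegral_cube_exp_le hC hCx hα hα2 hR hcard hv _).trans ?_
          rw [← ENNReal.ofReal_mul (Real.exp_pos _).le, ← Real.exp_add, mul_pow, mul_pow,
            Real.sq_sqrt hr]
          refine ENNReal.ofReal_le_ofReal (Real.exp_le_exp.2 ?_)
          -- With `s = 2 √r g` the quadratic term is `32 C R ^ (2 - α) r g ^ 2`; the factor `128`
          -- makes it at most `g ^ 2 / 4`.
          nlinarith [mul_le_mul_of_nonneg_right hr' (sq_nonneg g)]
      _ ≤ ENNReal.ofReal (Real.exp (2 * C ^ 2)) * 2 := by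
          rw [lintegral_const_mul _ (by fun_prop)]
          gcongr
          exact lintegral_exp_sq_div_four_gaussianReal_le
      _ = _ := by
          rw [mul_comm, ENNReal.ofReal_mul zero_le_two]; simp
  · refine Measurable.aemeasurable ?_
    have : (Function.uncurry fun (x : ι → ℝ) (g : ℝ) => (cube ι R).indicator (fun x =>
        ENNReal.ofReal (Real.exp ((2 * Real.sqrt r * g) * ∑ k, v k * x k))) x) =
        (Prod.fst ⁻¹' cube ι R).indicator fun z : (ι → ℝ) × ℝ =>
          ENNReal.ofReal (Real.exp ((2 * Real.sqrt r * z.2) * ∑ k, v k * z.1 k)) := by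
      ext ⟨x, g⟩
      rfl
    rw [this]
    exact Measurable.indicator (by fun_prop) (measurable_fst (measurableSet_cube R))

theorem lintegral_sum_pow_four_le {C : ℝ} (hC : 0 ≤ C)
    (hCx : ∀ x : ℝ, 1 + x ^ 4 ≤ C * Real.exp (|x| ^ α / 16)) (hα : 0 < α)
    (h : IsCenteredSubWeibull α ρ) {v : ι → ℝ} (hv : ∑ k, v k ^ 2 ≤ 1) :
    ∫⁻ x, ENNReal.ofReal ((∑ k, v k * x k) ^ 4) ∂Measure.pi (fun _ : ι => ρ) ≤
      ENNReal.ofReal (6 * C) := by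
  have := h.isProbabilityMeasure
  have hi := fun k => measurePreserving_eval (fun _ : ι => ρ) k
  have hint : Integrable (fun x : ℝ => x ^ 4) ρ := h.integrable_pow_four hα
  obtain ⟨h1, h2⟩ := integral_sum_pow_four_le (P := Measure.pi fun _ : ι => ρ)
    (X := fun k x => v k * x k) (a := fun k => v k ^ 2 * Real.sqrt (2 * C))
    (iIndepFun_pi (X := fun k y => v k * y) fun k => by fun_prop) (fun k => by fun_prop)
    (fun k => by
      simp_rw [mul_pow]
      exact ((hi k).integrable_comp_of_integrable hint).const_mul _)
    (fun k => by
      rw [integral_const_mul, integral_comp_eval (i := k) (f := fun y : ℝ => y)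
        (μ := fun _ : ι => ρ) (by fun_prop), h.mean_zero, mul_zero])
    (fun k => by positivity)
    (fun k => by
      simp_rw [mul_pow]
      rw [integral_const_mul, integral_comp_eval (i := k) (f := fun y : ℝ => y ^ 4)
        (μ := fun _ : ι => ρ) (by fun_prop), ← pow_mul, Real.sq_sqrt (by positivity)]
      gcongr
      exact h.integral_pow_four_le hC hCx)
    Finset.univ
  rw [← ofReal_integral_eq_lintegral_ofReal h1 (Filter.Eventually.of_forall fun _ => by positivity)]
  refine ENNReal.ofReal_le_ofReal (h2.trans ?_)
  rw [← Finset.sum_mul, mul_pow, Real.sq_sqrt (by positivity)]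
  have : (∑ k, v k ^ 2) ^ 2 ≤ 1 := pow_le_one₀ (Finset.sum_nonneg fun _ _ => sq_nonneg _) hv
  nlinarith

/-- The constant in the exponential moment bound for the squared projections. -/
noncomputable def momentConst (C : ℝ) : ℝ := 3 * C + Real.exp (2 * C ^ 2)

/-- The exponent has to be linear in `r`: a constant prefactor, raised to the number of columns and
divided by `r` in Chernoff, would cost `p * R ^ (2 - α)` instead of `p`. The gain comes from `exp (r
z) ≤ 1 + (r / 2) (z ^ 2 + exp (2 r z))`, with `z` the squared projection. -/
theorem lintegral_cube_exp_sq_le_exp {C : ℝ} (hC : 1 ≤ C)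
    (hCx : ∀ x : ℝ, 1 + x ^ 4 ≤ C * Real.exp (|x| ^ α / 16)) (hα : 0 < α) (hα2 : α ≤ 2)
    (h : IsCenteredSubWeibull α ρ) {R : ℝ} (hR : 1 ≤ R)
    (hcard : Fintype.card ι * Real.exp (-(R ^ α / 4)) ≤ 1) {v : ι → ℝ} (hv : ∑ k, v k ^ 2 ≤ 1)
    {r : ℝ} (hr : 0 ≤ r) (hr' : 128 * C * R ^ (2 - α) * r ≤ 1) :
    ∫⁻ x, (cube ι R).indicator
        (fun x => ENNReal.ofReal (Real.exp (r * (∑ k, v k * x k) ^ 2))) x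
        ∂Measure.pi (fun _ : ι => ρ) ≤ ENNReal.ofReal (Real.exp (r * momentConst C)) := by
  have := h.isProbabilityMeasure
  have hpt : ∀ x : ι → ℝ, (cube ι R).indicator
      (fun x => ENNReal.ofReal (Real.exp (r * (∑ k, v k * x k) ^ 2))) x ≤
      1 + ENNReal.ofReal (r / 2) * (ENNReal.ofReal ((∑ k, v k * x k) ^ 4) +
        (cube ι R).indicator
          (fun x => ENNReal.ofReal (Real.exp (2 * (r * (∑ k, v k * x k) ^ 2)))) x) := fun x => by
    by_cases hx : x ∈ cube ι R
    · simp_rw [Set.indicator_of_mem hx]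
      set z := (∑ k, v k * x k) ^ 2 with hz
      have hz4 : (∑ k, v k * x k) ^ 4 = z ^ 2 := by rw [hz]; ring
      rw [hz4, ← ENNReal.ofReal_add (by positivity) (by positivity),
        ← ENNReal.ofReal_mul (by positivity), ← ENNReal.ofReal_one,
        ← ENNReal.ofReal_add zero_le_one (by positivity)]
      refine ENNReal.ofReal_le_ofReal ?_
      have h1 : 1 - r * z ≤ Real.exp (-(r * z)) := by linarith [Real.add_one_le_exp (-(r * z))]
      have h2 : Real.exp (-(r * z)) * Real.exp (r * z) = 1 := by rw [← Real.exp_add]; simp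
      have h3 : Real.exp (2 * (r * z)) = Real.exp (r * z) ^ 2 := by
        rw [← Real.exp_nat_mul]; norm_num
      rw [h3]
      have h4 := mul_le_mul_of_nonneg_right h1 (Real.exp_pos (r * z)).le
      nlinarith [mul_nonneg hr (sq_nonneg (z - Real.exp (r * z)))]
    · rw [Set.indicator_of_notMem hx]; exact zero_le
  refine (lintegral_mono hpt).trans ?_
  rw [lintegral_add_left measurable_const, lintegral_const_mul', lintegral_add_left (by fun_prop)]
  · simp only [lintegral_const, measure_univ, mul_one]
    calc _ ≤ 1 + ENNReal.ofReal (r / 2) * (ENNReal.ofReal (6 * C) +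
            ENNReal.ofReal (2 * Real.exp (2 * C ^ 2))) := by
          gcongr
          · exact h.lintegral_sum_pow_four_le (by linarith) hCx hα hv
          · exact h.lintegral_cube_exp_sq_le hC hCx hα hα2 hR hcard hv hr hr'
      _ = ENNReal.ofReal (1 + r * momentConst C) := by
          rw [← ENNReal.ofReal_add (by positivity) (by positivity),
            ← ENNReal.ofReal_mul (by positivity), ← ENNReal.ofReal_one,
            ← ENNReal.ofReal_add zero_le_one (by positivity), momentConst]
          ring_nf
      _ ≤ _ := ENNReal.ofReal_le_ofReal (by linarith [Real.add_one_le_exp (r * momentConst C)])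
  · exact ENNReal.ofReal_ne_top

end IsCenteredSubWeibull

/-! ### Deviation bounds for the random matrix -/

section RandomMatrix

variable {α : ℝ} {ι κ : Type*} [Fintype ι] [Fintype κ] {ν : κ → Measure ℝ}

theorem lintegral_prod_column_le (hν : ∀ j, IsProbabilityMeasure (ν j))
    {f : (ι → ℝ) → ℝ≥0∞} (hf : Measurable f) {b : ℝ≥0∞}
    (hb : ∀ j, ∫⁻ x, f x ∂Measure.pi (fun _ : ι => ν j) ≤ b) :
    ∫⁻ Q, ∏ j, f (fun k => Q k j) ∂Measure.pi (fun _ : ι => Measure.pi ν) ≤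
      b ^ Fintype.card κ := by
  have hmap : ∫⁻ Q, ∏ j, f (fun k => Q k j) ∂Measure.pi (fun _ : ι => Measure.pi ν) =
      ∫⁻ Q', ∏ j, f (Q' j) ∂Measure.pi fun j => Measure.pi fun _ : ι => ν j := by
    rw [← pi_pi_map_flip (ι := ι) ν, lintegral_map (by fun_prop) (by fun_prop)]
  rw [hmap, lintegral_pi_prod (fun j => Measure.pi fun _ : ι => ν j) fun _ => hf]
  refine (Finset.prod_le_prod' fun j _ => hb j).trans ?_
  simp

theorem measure_sum_sq_ge_le {C : ℝ} (hC : 1 ≤ C)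
    (hCx : ∀ x : ℝ, 1 + x ^ 4 ≤ C * Real.exp (|x| ^ α / 16)) (hα : 0 < α) (hα2 : α ≤ 2)
    (hν : ∀ j, IsCenteredSubWeibull α (ν j)) {R : ℝ} (hR : 1 ≤ R)
    (hcard : Fintype.card ι * Real.exp (-(R ^ α / 4)) ≤ 1) {v : ι → ℝ} (hv : ∑ k, v k ^ 2 ≤ 1)
    {r : ℝ} (hr : 0 ≤ r) (hr' : 128 * C * R ^ (2 - α) * r ≤ 1) (t : ℝ) :
    Measure.pi (fun _ : ι => Measure.pi ν)
        {Q | (∀ k j, Q k j ∈ Set.Icc (-R) R) ∧ t ≤ ∑ j, (∑ k, v k * Q k j) ^ 2} ≤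
      ENNReal.ofReal (Real.exp
        (r * (IsCenteredSubWeibull.momentConst C * Fintype.card κ - t))) := by
  have := fun j => (hν j).isProbabilityMeasure
  set f : (ι → ℝ) → ℝ≥0∞ := (cube ι R).indicator
    (fun x => ENNReal.ofReal (Real.exp (r * (∑ k, v k * x k) ^ 2))) with hf
  have hfm : Measurable f := Measurable.indicator (by fun_prop) (measurableSet_cube R)
  have hI := lintegral_prod_column_le this hfm fun j =>
    (hν j).lintegral_cube_exp_sq_le_exp hC hCx hα hα2 hR hcard hv hr hr'
  have hM := mul_meas_ge_le_lintegral (μ := Measure.pi (fun _ : ι => Measure.pi ν))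
    (f := fun Q => ∏ j, f (fun k => Q k j)) (by fun_prop) (ENNReal.ofReal (Real.exp (r * t)))
  have hsub : {Q : ι → κ → ℝ | (∀ k j, Q k j ∈ Set.Icc (-R) R) ∧
      t ≤ ∑ j, (∑ k, v k * Q k j) ^ 2} ⊆
      {Q | ENNReal.ofReal (Real.exp (r * t)) ≤ ∏ j, f (fun k => Q k j)} := by
    rintro Q ⟨hQ, ht⟩
    have e : ∀ j, f (fun k => Q k j) =
        ENNReal.ofReal (Real.exp (r * (∑ k, v k * Q k j) ^ 2)) := fun j =>
      Set.indicator_of_mem (show (fun k => Q k j) ∈ cube ι R from fun k _ => hQ k j) _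
    simp only [Set.mem_ofPred_eq, e]
    rw [← ENNReal.ofReal_prod_of_nonneg fun _ _ => (Real.exp_pos _).le, ← Real.exp_sum,
      ← Finset.mul_sum]
    gcongr
  have h1 := (mul_le_mul_right (measure_mono hsub) _).trans (hM.trans hI)
  rw [← ENNReal.ofReal_pow (Real.exp_pos _).le, ← Real.exp_nat_mul] at h1
  have h2 : ENNReal.ofReal (Real.exp (Fintype.card κ * (r * IsCenteredSubWeibull.momentConst C))) =
      ENNReal.ofReal (Real.exp (r * t)) * ENNReal.ofReal (Real.exp
        (r * (IsCenteredSubWeibull.momentConst C * Fintype.card κ - t))) := by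
    rw [← ENNReal.ofReal_mul (Real.exp_pos _).le, ← Real.exp_add]
    ring_nf
  rw [h2] at h1
  exact (ENNReal.mul_le_mul_iff_right (by simp [Real.exp_pos]) (by simp)).1 h1

theorem measure_exists_entry_notMem_le (hα : 0 < α) (hν : ∀ j, IsCenteredSubWeibull α (ν j))
    {R : ℝ} (hR : 0 ≤ R) :
    Measure.pi (fun _ : ι => Measure.pi ν) {Q | ∃ k j, Q k j ∉ Set.Icc (-R) R} ≤
      ENNReal.ofReal (Fintype.card ι * (Fintype.card κ * (2 * Real.exp (-(R ^ α / 4))))) := by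
  have := fun j => (hν j).isProbabilityMeasure
  have e : {Q : ι → κ → ℝ | ∃ k j, Q k j ∉ Set.Icc (-R) R} =
      ⋃ k, ⋃ j, (fun Q => Q k j) ⁻¹' (Set.Icc (-R) R)ᶜ := by
    ext Q; simp only [Set.mem_ofPred_eq, Set.mem_iUnion, Set.mem_preimage, Set.mem_compl_iff]
  rw [e]
  have hkj : ∀ k j, Measure.pi (fun _ : ι => Measure.pi ν)
      ((fun Q => Q k j) ⁻¹' (Set.Icc (-R) R)ᶜ) ≤
      ENNReal.ofReal (2 * Real.exp (-(R ^ α / 4))) := fun k j => by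
    have hmp := (measurePreserving_eval ν j).comp
      (measurePreserving_eval (fun _ : ι => Measure.pi ν) k)
    refine le_trans (le_of_eq ?_) ((hν j).measure_compl_Icc_le hα hR)
    exact hmp.measure_preimage measurableSet_Icc.compl.nullMeasurableSet
  refine (measure_iUnion_fintype_le _ _).trans ?_
  refine (Finset.sum_le_sum fun k _ => (measure_iUnion_fintype_le _ _).trans
    (Finset.sum_le_sum fun j _ => hkj k j)).trans ?_
  rw [ENNReal.ofReal_mul (by positivity), ENNReal.ofReal_mul (by positivity)]
  simp

/-- This removes the logarithm created by truncation: `(log p) ^ (2 / α)` is at most a constant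
times `p`. -/
theorem rpow_mul_le_of_log {α L p : ℝ} (hα : 0 < α) (hL : 1 ≤ L) (hp : 1 ≤ p) :
    (4 * (L + Real.log p)) ^ ((2 - α) / α) * L ≤
      8 ^ (2 / α) * (L ^ (2 / α) + (2 / α) ^ (2 / α) * p) := by
  set β := 2 / α with hβ
  have hβ0 : 0 < β := by positivity
  have hlog : 0 ≤ Real.log p := Real.log_nonneg hp
  have hb : (2 - α) / α = β - 1 := by rw [hβ]; field_simp
  have hpos : 0 < 4 * (L + Real.log p) := by linarith
  have h1 : (4 * (L + Real.log p)) ^ ((2 - α) / α) * L ≤ (4 * (L + Real.log p)) ^ β := by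
    rw [hb, Real.rpow_sub_one hpos.ne', div_mul_eq_mul_div, div_le_iff₀ hpos]
    gcongr
    linarith
  have h2 : Real.log p ^ β ≤ β ^ β * p := by
    have h3 : Real.log p ≤ p ^ (1 / β) / (1 / β) :=
      Real.log_le_rpow_div (by linarith) (by positivity)
    have h4 := Real.rpow_le_rpow hlog h3 hβ0.le
    rw [div_div_eq_mul_div, div_one, Real.mul_rpow (by positivity) hβ0.le,
      ← Real.rpow_mul (by linarith), one_div_mul_cancel hβ0.ne', Real.rpow_one] at h4
    linarith
  have h5 : (4 * (L + Real.log p)) ^ β ≤ 8 ^ β * (L ^ β + Real.log p ^ β) := by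
    have hL0 : 0 ≤ L ^ β := by positivity
    have hl0 : 0 ≤ Real.log p ^ β := by positivity
    rcases le_total L (Real.log p) with hle | hle
    · calc (4 * (L + Real.log p)) ^ β ≤ (8 * Real.log p) ^ β :=
          Real.rpow_le_rpow hpos.le (by linarith) hβ0.le
        _ = 8 ^ β * Real.log p ^ β := Real.mul_rpow (by norm_num) hlog
        _ ≤ _ := by gcongr; linarith
    · calc (4 * (L + Real.log p)) ^ β ≤ (8 * L) ^ β :=
          Real.rpow_le_rpow hpos.le (by linarith) hβ0.le
        _ = 8 ^ β * L ^ β := Real.mul_rpow (by norm_num) (by linarith)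
        _ ≤ _ := by gcongr; linarith
  refine h1.trans (h5.trans ?_)
  gcongr

/-- Uniform deviation bound for the squared norms of finitely many combinations of the rows of a
random matrix with independent centered sub-Weibull entries. -/
theorem exists_forall_measure_exists_sum_sq_gt_le (hα : 0 < α) (hα2 : α ≤ 2) :
    ∃ a b : ℝ, 0 < a ∧ 0 < b ∧ ∀ {ι κ : Type} [Fintype ι] [Fintype κ] [Nonempty κ]
      (ν : κ → Measure ℝ), (∀ j, IsCenteredSubWeibull α (ν j)) →
      ∀ (N : Finset (ι → ℝ)), (∀ v ∈ N, ∑ k, v k ^ 2 ≤ 1) →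
      ∀ (L : ℝ), 1 ≤ L → Fintype.card ι * Real.exp (-L) ≤ 1 →
      Measure.pi (fun _ : ι => Measure.pi ν)
        {Q | ∃ v ∈ N, a * Fintype.card κ + b * L ^ (2 / α) < ∑ j, (∑ k, v k * Q k j) ^ 2} ≤
      ENNReal.ofReal ((2 * Fintype.card ι + N.card) * Real.exp (-L)) := by
  obtain ⟨C, hC, hCx⟩ := exists_one_add_pow_four_le_exp hα
  set M := IsCenteredSubWeibull.momentConst C with hM
  have hM0 : 0 < M := by rw [hM, IsCenteredSubWeibull.momentConst]; positivity
  refine ⟨M + 128 * C * (8 ^ (2 / α) * (2 / α) ^ (2 / α)), 128 * C * 8 ^ (2 / α), by positivity,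
    by positivity, ?_⟩
  intro ι κ _ _ _ ν hν N hN L hL hcard
  set p : ℝ := (Fintype.card κ : ℝ) with hp
  have hp1 : 1 ≤ p := by rw [hp]; exact_mod_cast Fintype.card_pos
  have hlog : 0 ≤ Real.log p := Real.log_nonneg hp1
  -- This makes `exp (-(R ^ α / 4)) = exp (-L) / p`, so the union bound over all entries costs only
  -- `2 * card ι * exp (-L)`.
  set R := (4 * (L + Real.log p)) ^ (1 / α) with hRdef
  have h41 : 1 ≤ 4 * (L + Real.log p) := by linarith
  have hR : 1 ≤ R := Real.one_le_rpow h41 (by positivity)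
  have hRα : R ^ α / 4 = L + Real.log p := by
    rw [hRdef, ← Real.rpow_mul (by linarith), one_div_mul_cancel hα.ne', Real.rpow_one]
    ring
  have hRD : R ^ (2 - α) = (4 * (L + Real.log p)) ^ ((2 - α) / α) := by
    rw [hRdef, ← Real.rpow_mul (by linarith)]; ring_nf
  have hexp : Real.exp (-(R ^ α / 4)) = Real.exp (-L) / p := by
    rw [hRα, neg_add, Real.exp_add, Real.exp_neg (Real.log p), Real.exp_log (by linarith)]
    rfl
  have hcard' : Fintype.card ι * Real.exp (-(R ^ α / 4)) ≤ 1 := by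
    refine le_trans ?_ hcard
    rw [hexp]
    gcongr
    exact div_le_self (Real.exp_pos _).le hp1
  have hD0 : 0 < R ^ (2 - α) := by positivity
  -- The largest rate that the exponential moment bound allows.
  set r := (128 * C * R ^ (2 - α))⁻¹ with hr
  have hr0 : 0 < r := by positivity
  have hr1 : 128 * C * R ^ (2 - α) * r ≤ 1 := (mul_inv_cancel₀ (by positivity)).le
  set t := (M + 128 * C * (8 ^ (2 / α) * (2 / α) ^ (2 / α))) * p +
    128 * C * 8 ^ (2 / α) * L ^ (2 / α) with ht
  have hrt : r * (M * p - t) ≤ -L := by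
    have h1 := rpow_mul_le_of_log hα hL hp1
    rw [← hRD] at h1
    have h2 : 128 * C * R ^ (2 - α) * L ≤ t - M * p := by
      rw [ht]; nlinarith
    have h3 : L ≤ r * (t - M * p) := by
      rw [hr, le_inv_mul_iff₀ (by positivity)]; exact h2
    linarith
  have hsub : {Q : ι → κ → ℝ | ∃ v ∈ N, t < ∑ j, (∑ k, v k * Q k j) ^ 2} ⊆
      {Q | ∃ k j, Q k j ∉ Set.Icc (-R) R} ∪ ⋃ v ∈ N,
        {Q | (∀ k j, Q k j ∈ Set.Icc (-R) R) ∧ t ≤ ∑ j, (∑ k, v k * Q k j) ^ 2} := by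
    rintro Q ⟨v, hv, hlt⟩
    by_cases hQ : ∀ k j, Q k j ∈ Set.Icc (-R) R
    · exact Or.inr (Set.mem_biUnion hv ⟨hQ, hlt.le⟩)
    · left
      simpa only [not_forall, Set.mem_ofPred_eq] using hQ
  refine (measure_mono hsub).trans ((measure_union_le _ _).trans ?_)
  have hA := measure_exists_entry_notMem_le (ι := ι) hα hν (by linarith : 0 ≤ R)
  have hB : Measure.pi (fun _ : ι => Measure.pi ν) (⋃ v ∈ N,
      {Q | (∀ k j, Q k j ∈ Set.Icc (-R) R) ∧ t ≤ ∑ j, (∑ k, v k * Q k j) ^ 2}) ≤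
      ENNReal.ofReal (N.card * Real.exp (-L)) := by
    refine (measure_biUnion_finset_le _ _).trans ?_
    refine (Finset.sum_le_sum fun v hv => (measure_sum_sq_ge_le hC hCx hα hα2 hν hR hcard'
      (hN v hv) hr0.le hr1 t).trans (ENNReal.ofReal_le_ofReal (Real.exp_le_exp.2 hrt))).trans ?_
    rw [ENNReal.ofReal_mul (by positivity)]
    simp
  refine (add_le_add hA hB).trans ?_
  rw [← ENNReal.ofReal_add (by positivity) (by positivity), hexp, ← hp]
  refine ENNReal.ofReal_le_ofReal (le_of_eq ?_)
  field_simp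

end RandomMatrix

/-! ### Nets and singular values -/

/-- The unit ball of a finite-dimensional space has a `1/2`-net of cardinality at most `5 ^ d`. -/
theorem exists_finset_half_net (E : Type*) [NormedAddCommGroup E] [NormedSpace ℝ E]
    [FiniteDimensional ℝ E] :
    ∃ N : Finset E, N.card ≤ 5 ^ Module.finrank ℝ E ∧ (∀ v ∈ N, ‖v‖ ≤ 1) ∧
      ∀ x : E, ‖x‖ ≤ 1 → ∃ v ∈ N, ‖x - v‖ ≤ 1 / 2 := by
  classical
  let good : Finset E → Prop := fun s =>
    (∀ v ∈ s, ‖v‖ ≤ 1) ∧ ∀ v ∈ s, ∀ w ∈ s, v ≠ w → 1 / 2 ≤ ‖v - w‖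
  have hbound : ∀ s, good s → s.card ≤ 5 ^ Module.finrank ℝ E := by
    rintro s ⟨h1, h2⟩
    -- Doubling turns `1/2`-separation in the unit ball into `1`-separation in the ball of radius
    -- `2`, the normalization of the packing bound.
    have hinj : Function.Injective fun x : E => (2 : ℝ) • x := smul_right_injective E two_ne_zero
    rw [← Finset.card_image_of_injective s hinj]
    refine Besicovitch.card_le_of_separated _ ?_ ?_
    · intro c hc
      obtain ⟨v, hv, rfl⟩ := Finset.mem_image.1 hc
      rw [norm_smul, Real.norm_two]
      linarith [h1 v hv]
    · intro c hc d hd hcd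
      obtain ⟨v, hv, rfl⟩ := Finset.mem_image.1 hc
      obtain ⟨w, hw, rfl⟩ := Finset.mem_image.1 hd
      simp only [← smul_sub, norm_smul, Real.norm_two]
      linarith [h2 v hv w hw fun h => hcd (by rw [h])]
  -- A separated set of maximal cardinality is a net, since an uncovered point could be added.
  obtain ⟨N, hN, hcard⟩ := Nat.findGreatest_spec (P := fun m => ∃ s, good s ∧ s.card = m)
    (Nat.zero_le (5 ^ Module.finrank ℝ E)) ⟨∅, by simp [good], rfl⟩
  refine ⟨N, hbound N hN, hN.1, fun x hx => ?_⟩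
  by_contra! hfar
  have hxN : x ∉ N := fun h => by have := hfar x h; simp at this; linarith
  have hgood : good (insert x N) := by
    refine ⟨fun v hv => ?_, fun v hv w hw hvw => ?_⟩
    · rcases Finset.mem_insert.1 hv with rfl | hv
      exacts [hx, hN.1 v hv]
    · rcases Finset.mem_insert.1 hv with rfl | hv' <;> rcases Finset.mem_insert.1 hw with rfl | hw'
      · exact absurd rfl hvw
      · exact (hfar w hw').le
      · rw [norm_sub_rev]; exact (hfar v hv').le
      · exact hN.2 v hv' w hw' hvw
  have := Nat.le_findGreatest (P := fun m => ∃ s, good s ∧ s.card = m) (hbound _ hgood)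
    ⟨_, hgood, rfl⟩
  rw [Finset.card_insert_of_notMem hxN, hcard] at this
  omega

/-- The norm of a linear map is controlled by its values on a `1/2`-net. -/
theorem LinearMap.norm_le_of_half_net {E F : Type*} [NormedAddCommGroup E] [NormedSpace ℝ E]
    [FiniteDimensional ℝ E] [NormedAddCommGroup F] [NormedSpace ℝ F] (f : E →ₗ[ℝ] F) {N : Finset E}
    (hN : ∀ x : E, ‖x‖ ≤ 1 → ∃ v ∈ N, ‖x - v‖ ≤ 1 / 2) {T : ℝ} (hT : 0 ≤ T)
    (hf : ∀ v ∈ N, ‖f v‖ ≤ T) (x : E) : ‖f x‖ ≤ 2 * T * ‖x‖ := by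
  set g := LinearMap.toContinuousLinearMap f with hg
  have hgf : ∀ x, g x = f x := fun x => rfl
  have hnorm : ‖g‖ ≤ T + ‖g‖ * (1 / 2) := by
    refine g.opNorm_le_of_unit_norm (by positivity) fun x hx => ?_
    obtain ⟨v, hv, hxv⟩ := hN x hx.le
    calc ‖g x‖ = ‖g v + g (x - v)‖ := by rw [← map_add]; simp
      _ ≤ ‖g v‖ + ‖g (x - v)‖ := norm_add_le _ _
      _ ≤ T + ‖g‖ * (1 / 2) := by
          gcongr
          · exact hf v hv
          · exact (g.le_opNorm _).trans (by gcongr)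
  rw [← hgf]
  refine (g.le_opNorm x).trans ?_
  gcongr
  linarith

/-- An eigenvector `x` of the adjoint composed with `f`, for the eigenvalue `σ ^ 2`, satisfies `σ
‖x‖ = ‖f x‖`. -/
theorem LinearMap.singularValues_le {E F : Type*} [NormedAddCommGroup E] [InnerProductSpace ℝ E]
    [FiniteDimensional ℝ E] [NormedAddCommGroup F] [InnerProductSpace ℝ F] [FiniteDimensional ℝ F]
    (f : E →ₗ[ℝ] F) {c : ℝ} (hc : 0 ≤ c) (hf : ∀ x, ‖f x‖ ≤ c * ‖x‖) (i : ℕ) :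
    f.singularValues i ≤ c := by
  by_cases hi : Module.finrank ℝ E ≤ i
  · rw [f.singularValues_of_finrank_le hi]; exact hc
  · obtain ⟨x, hx⟩ := (f.hasEigenvalue_adjoint_comp_self_sq_singularValues
      (not_le.1 hi)).exists_hasEigenvector
    have hx0 : 0 < ‖x‖ := norm_pos_iff.2 hx.2
    have h1 := hx.apply_eq_smul
    have h2 : inner ℝ (LinearMap.adjoint f (f x)) x = ‖f x‖ ^ 2 := by
      rw [LinearMap.adjoint_inner_left, real_inner_self_eq_norm_sq]
    rw [LinearMap.comp_apply] at h1
    rw [h1, inner_smul_left, real_inner_self_eq_norm_sq] at h2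
    simp only [RCLike.ofReal_real_eq_id, id_eq, conj_trivial] at h2
    have h3 : (f.singularValues i * ‖x‖) ^ 2 ≤ (c * ‖x‖) ^ 2 := by
      rw [mul_pow, h2]
      have := hf x
      gcongr
    have h4 := le_of_sq_le_sq h3 (by positivity)
    exact le_of_mul_le_mul_right h4 hx0

theorem abs_labelVal (y : ℤˣ) : |labelVal y| = 1 := by
  rcases Int.units_eq_one_or y with rfl | rfl <;> simp [labelVal]

theorem labelVal_sq (y : ℤˣ) : labelVal y ^ 2 = 1 := by
  rw [← sq_abs, abs_labelVal, one_pow]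

/-- Changing the signs of the columns does not affect bounds on the top singular value. -/
theorem topSingularValue_dataMatrix_le {n p : ℕ} (S : Fin n → EuclideanSpace ℝ (Fin p) × ℤˣ)
    {N : Finset (EuclideanSpace ℝ (Fin n))}
    (hN : ∀ x : EuclideanSpace ℝ (Fin n), ‖x‖ ≤ 1 → ∃ v ∈ N, ‖x - v‖ ≤ 1 / 2) {T : ℝ} (hT : 0 ≤ T)
    (hS : ∀ v ∈ N, ‖∑ k, v k • (S k).1‖ ≤ T) : topSingularValue (dataMatrix S) ≤ 2 * T := by
  let f : EuclideanSpace ℝ (Fin n) →ₗ[ℝ] EuclideanSpace ℝ (Fin p) :=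
    { toFun := fun v => ∑ k, v k • (S k).1
      map_add' := fun v w => by simp [add_smul, Finset.sum_add_distrib]
      map_smul' := fun c v => by simp [mul_smul, Finset.smul_sum] }
  refine LinearMap.singularValues_le _ (by positivity) (fun x => ?_) 0
  set x' : EuclideanSpace ℝ (Fin n) := WithLp.toLp 2 fun k => labelVal (S k).2 * x k with hx'
  have h1 : Matrix.toEuclideanLin (dataMatrix S) x = f x' := by
    ext i
    simp only [Matrix.toLpLin_apply, Matrix.mulVec, dotProduct, dataMatrix, Matrix.of_apply, f,
      hx', LinearMap.coe_mk, AddHom.coe_mk, WithLp.ofLp_sum, Finset.sum_apply, PiLp.smul_apply,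
      smul_eq_mul]
    exact Finset.sum_congr rfl fun k _ => by ring
  have h2 : ‖x'‖ = ‖x‖ := by
    rw [EuclideanSpace.norm_eq, EuclideanSpace.norm_eq]
    simp [hx', abs_labelVal]
  rw [h1, ← h2]
  exact f.norm_le_of_half_net hN hT hS x'

/-! ### Reduction from the noisy sample to the clean noise matrix -/

theorem norm_toLp_mulVec_of_mem_orthogonalGroup {p : ℕ} {U : Matrix (Fin p) (Fin p) ℝ}
    (hU : U ∈ Matrix.orthogonalGroup (Fin p) ℝ) (w : Fin p → ℝ) :
    ‖(WithLp.toLp 2 (U.mulVec w) : EuclideanSpace ℝ (Fin p))‖ =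
      ‖(WithLp.toLp 2 w : EuclideanSpace ℝ (Fin p))‖ := by
  have e : ∀ u : Fin p → ℝ, ‖(WithLp.toLp 2 u : EuclideanSpace ℝ (Fin p))‖ ^ 2 = u ⬝ᵥ u :=
      fun u => by
    rw [EuclideanSpace.norm_sq_eq]; simp [dotProduct, sq]
  have h1 := (Matrix.mem_orthogonalGroup_iff' (Fin p) ℝ).1 hU
  rw [← sq_eq_sq₀ (norm_nonneg _) (norm_nonneg _), e, e, Matrix.dotProduct_mulVec,
    Matrix.vecMul_mulVec]
  rw [h1, Matrix.vecMul_one]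

theorem norm_sum_smul_clean_le {n p : ℕ} {U : Matrix (Fin p) (Fin p) ℝ}
    (hU : U ∈ Matrix.orthogonalGroup (Fin p) ℝ) (μ : EuclideanSpace ℝ (Fin p))
    {v : EuclideanSpace ℝ (Fin n)} (hv : ‖v‖ ≤ 1) (z : Fin n → (Fin p → ℝ) × ℤˣ) {t : ℝ}
    (ht : ∑ j, (∑ k, v k * (z k).1 j) ^ 2 ≤ t) :
    ‖∑ k, v k • (WithLp.toLp 2 (U.mulVec (z k).1) + labelVal (z k).2 • μ)‖ ≤
      Real.sqrt t + Real.sqrt n * ‖μ‖ := by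
  simp_rw [smul_add, Finset.sum_add_distrib, smul_smul]
  refine (norm_add_le _ _).trans (add_le_add ?_ ?_)
  · have e : ∑ k, v k • (WithLp.toLp 2 (U.mulVec (z k).1) : EuclideanSpace ℝ (Fin p)) =
        WithLp.toLp 2 (U.mulVec fun j => ∑ k, v k * (z k).1 j) := by
      have : (fun j => ∑ k, v k * (z k).1 j) = ∑ k, v k • (z k).1 := by ext j; simp
      rw [this, Matrix.mulVec_sum, WithLp.toLp_sum]
      simp [Matrix.mulVec_smul]
    rw [e, norm_toLp_mulVec_of_mem_orthogonalGroup hU, EuclideanSpace.norm_eq]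
    refine Real.sqrt_le_sqrt ?_
    simpa using ht
  · rw [← Finset.sum_smul, norm_smul]
    gcongr
    rw [Real.norm_eq_abs]
    refine Real.abs_le_sqrt ?_
    have hv2 : ∑ k, v k ^ 2 ≤ 1 := by
      have := EuclideanSpace.real_norm_sq_eq v
      rw [← this]; exact pow_le_one₀ (norm_nonneg _) hv
    have := Finset.sum_mul_sq_le_sq_mul_sq Finset.univ (fun k => v k)
      (fun k => labelVal (z k).2)
    simp only [labelVal_sq, Finset.sum_const, Finset.card_univ, Fintype.card_fin, nsmul_eq_mul,
      mul_one] at this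
    nlinarith [Nat.cast_nonneg (α := ℝ) n]

theorem isCenteredSubWeibull_of_orliczNorm_le_one {α : ℝ} (hα : 0 < α) (hα2 : α ≤ 2)
    {ρ : Measure ℝ} [IsProbabilityMeasure ρ] (h0 : ∫ x, x ∂ρ = 0)
    (h : orliczNorm α (fun x : ℝ => x) ρ ≤ 1) : IsCenteredSubWeibull α ρ where
  isProbabilityMeasure := inferInstance
  mean_zero := h0
  lintegral_exp_le := by
    have h2 : orliczNorm α (fun x : ℝ => x) ρ < 2 := h.trans_lt (by norm_num)
    rw [orliczNorm, sInf_lt_iff] at h2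
    obtain ⟨_, ⟨t, ⟨ht0, ht⟩, rfl⟩, htlt⟩ := h2
    -- The infimum need not be attained, hence an admissible `t < 2`; then `t ^ α ≤ 4`, the source
    -- of the rate `1/4`.
    have ht2 : t ≤ 2 := by
      have : ENNReal.ofReal t < ENNReal.ofReal 2 := by simpa using htlt
      exact ((ENNReal.ofReal_lt_ofReal_iff two_pos).1 this).le
    refine le_trans (lintegral_mono fun x => ?_) ht
    have h4 : t ^ α ≤ 4 := by
      calc t ^ α ≤ 2 ^ α := by gcongr
        _ ≤ 2 ^ (2 : ℝ) := Real.rpow_le_rpow_of_exponent_le one_le_two hα2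
        _ = 4 := by norm_num
    gcongr

instance : IsProbabilityMeasure uniformLabel := by
  unfold uniformLabel; infer_instance

/-- The inputs of an i.i.d. noisy sample violate a bound on a finite set of linear combinations with
at most the probability that the clean noise vectors do. -/
theorem measure_exists_norm_gt_le {n p : ℕ} {ν : Fin p → Measure ℝ}
    (hν : ∀ j, IsProbabilityMeasure (ν j)) {U : Matrix (Fin p) (Fin p) ℝ}
    (hU : U ∈ Matrix.orthogonalGroup (Fin p) ℝ) (μ : EuclideanSpace ℝ (Fin p))
    {P : Measure (EuclideanSpace ℝ (Fin p) × ℤˣ)}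
    (hP : P.map Prod.fst = (cleanLaw ν U μ).map Prod.fst)
    {Ω : Type*} [MeasurableSpace Ω] {Pr : Measure Ω}
    {S : Fin n → Ω → EuclideanSpace ℝ (Fin p) × ℤˣ} (hS : ∀ k, HasLaw (S k) P Pr)
    (hind : iIndepFun S Pr) {N : Finset (EuclideanSpace ℝ (Fin n))} (hN : ∀ v ∈ N, ‖v‖ ≤ 1)
    (t : ℝ) :
    Pr {ω | ∃ v ∈ N, Real.sqrt t + Real.sqrt n * ‖μ‖ < ‖∑ k, v k • (S k ω).1‖} ≤
      Measure.pi (fun _ : Fin n => Measure.pi ν)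
        {Q | ∃ v ∈ N, t < ∑ j, (∑ k, v k * Q k j) ^ 2} := by
  set φ : (Fin p → ℝ) × ℤˣ → EuclideanSpace ℝ (Fin p) :=
    fun z => WithLp.toLp 2 (U.mulVec z.1) + labelVal z.2 • μ with hφ
  have hlab : Measurable labelVal := measurable_of_countable _
  have hφm : Measurable φ := by
    have : Measurable fun q : Fin p → ℝ => U.mulVec q :=
      (Continuous.matrix_mulVec continuous_const continuous_id).measurable
    fun_prop
  -- Equality of the input marginals is all that is needed to replace the noisy law by the clean
  -- one.
  have hfst : HasLaw Prod.fst (((Measure.pi ν).prod uniformLabel).map φ) P := by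
    refine ⟨by fun_prop, ?_⟩
    rw [hP, cleanLaw, Measure.map_map measurable_fst (by fun_prop)]
    rfl
  have hX : HasLaw (fun ω k => (S k ω).1)
      (Measure.pi fun _ : Fin n => ((Measure.pi ν).prod uniformLabel).map φ) Pr :=
    iIndepFun.hasLaw_pi (X := fun k ω => (S k ω).1) (fun k => hfst.comp (hS k))
      (hind.comp (fun _ => Prod.fst) fun _ => measurable_fst)
  have hB : MeasurableSet {x : Fin n → EuclideanSpace ℝ (Fin p) |
      ∃ v ∈ N, Real.sqrt t + Real.sqrt n * ‖μ‖ < ‖∑ k, v k • x k‖} := by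
    have : {x : Fin n → EuclideanSpace ℝ (Fin p) |
        ∃ v ∈ N, Real.sqrt t + Real.sqrt n * ‖μ‖ < ‖∑ k, v k • x k‖} =
        ⋃ v ∈ N, {x | Real.sqrt t + Real.sqrt n * ‖μ‖ < ‖∑ k, v k • x k‖} := by
      ext x; simp
    rw [this]
    exact Finset.measurableSet_biUnion _ fun v _ =>
      measurableSet_lt measurable_const (by fun_prop)
  have hpiφ : (Measure.pi fun _ : Fin n => ((Measure.pi ν).prod uniformLabel).map φ) =
      (Measure.pi fun _ : Fin n => (Measure.pi ν).prod uniformLabel).map fun z k => φ (z k) := by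
    have : ∀ _ : Fin n, IsProbabilityMeasure (((Measure.pi ν).prod uniformLabel).map φ) :=
      fun _ => Measure.isProbabilityMeasure_map hφm.aemeasurable
    exact (Measure.pi_map_pi fun _ => hφm.aemeasurable).symm
  have hQ : (Measure.pi fun _ : Fin n => Measure.pi ν) =
      (Measure.pi fun _ : Fin n => (Measure.pi ν).prod uniformLabel).map fun z k => (z k).1 := by
    have e : ((Measure.pi ν).prod uniformLabel).map Prod.fst = Measure.pi ν :=
      measurePreserving_fst.map_eq
    have : ∀ _ : Fin n, IsProbabilityMeasure (((Measure.pi ν).prod uniformLabel).map Prod.fst) :=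
      fun _ => by rw [e]; infer_instance
    rw [Measure.pi_map_pi fun _ => measurable_fst.aemeasurable, e]
  have hBQ : MeasurableSet {Q : Fin n → Fin p → ℝ |
      ∃ v ∈ N, t < ∑ j, (∑ k, v k * Q k j) ^ 2} := by
    have : {Q : Fin n → Fin p → ℝ | ∃ v ∈ N, t < ∑ j, (∑ k, v k * Q k j) ^ 2} =
        ⋃ v ∈ N, {Q | t < ∑ j, (∑ k, v k * Q k j) ^ 2} := by
      ext Q; simp
    rw [this]
    exact Finset.measurableSet_biUnion _ fun v _ => measurableSet_lt measurable_const (by fun_prop)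
  refine (hX.measure_eq hB).trans_le ?_
  rw [hpiφ, hQ, Measure.map_apply (by fun_prop) hB, Measure.map_apply (by fun_prop) hBQ]
  refine measure_mono ?_
  rintro z ⟨v, hv, hlt⟩
  refine ⟨v, hv, ?_⟩
  by_contra! hle
  exact absurd (norm_sum_smul_clean_le hU μ (hN v hv) z hle) (not_le.2 hlt)

/-! ### Numerical bounds and assembly -/

theorem two_mul_le_sqrt_mul_one_add_div {a x p : ℝ} (hp : 0 < p) (h : a ^ 2 ≤ x) :
    2 * a ≤ Real.sqrt p * (1 + x / p) := by
  have hs : 0 < Real.sqrt p := Real.sqrt_pos.2 hp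
  have hsq : Real.sqrt p ^ 2 = p := Real.sq_sqrt hp.le
  have e : Real.sqrt p * (1 + x / p) = Real.sqrt p + x / Real.sqrt p := by
    rw [mul_add, mul_one, ← mul_div_assoc, mul_comm, mul_div_assoc, Real.sqrt_div_self',
      mul_one_div]
  rw [e, ← sub_nonneg]
  have : Real.sqrt p + x / Real.sqrt p - 2 * a =
      ((Real.sqrt p - a) ^ 2 + (x - a ^ 2)) / Real.sqrt p := by
    field_simp
    ring
  rw [this]
  have := sub_nonneg.2 h
  positivity

/-- Both `n` and the net size are at most `9 ^ n`, so the total is at most `3 δ / 4`. -/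
theorem net_failure_prob_le {n : ℕ} {N : ℕ} (hN : N ≤ 5 ^ n) {δ : ℝ} (hδ : 0 < δ) :
    (2 * n + N) * Real.exp (-(n * Real.log 9 + Real.log (4 / δ))) ≤ δ := by
  have h9 : Real.exp (n * Real.log 9) = 9 ^ n := by
    rw [mul_comm, Real.exp_mul, Real.exp_log (by norm_num), Real.rpow_natCast]
  rw [Real.exp_neg, Real.exp_add, h9, Real.exp_log (by positivity)]
  have h1 : (N : ℝ) ≤ 9 ^ n := by
    calc (N : ℝ) ≤ 5 ^ n := by exact_mod_cast hN
      _ ≤ 9 ^ n := by gcongr; norm_num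
  have h2 : (n : ℝ) ≤ 9 ^ n := by exact_mod_cast (Nat.lt_pow_self (by norm_num)).le
  rw [← div_eq_mul_inv, div_le_iff₀ (by positivity)]
  have : δ * (9 ^ n * (4 / δ)) = 4 * 9 ^ n := by field_simp
  rw [this]
  have : (0 : ℝ) < 9 ^ n := by positivity
  linarith

theorem proposition3 (α : ℝ) (hα : 0 < α) (hα2 : α ≤ 2) :
    ∃ c₅ c₆ c₇ c₈ : ℝ, 0 < c₅ ∧ 0 < c₆ ∧ 0 < c₇ ∧ 0 < c₈ ∧
      ∀ (n p : ℕ), 0 < n → 0 < p →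
      ∀ (κ : ℝ), 0 < κ →
      ∀ (ν : Fin p → Measure ℝ), IsClusterFamily α κ ν →
      ∀ (U : Matrix (Fin p) (Fin p) ℝ), U ∈ Matrix.orthogonalGroup (Fin p) ℝ →
      ∀ (μ : EuclideanSpace ℝ (Fin p)) (η : ℝ), 0 ≤ η → η ≤ 1 →
      ∀ (P : Measure (EuclideanSpace ℝ (Fin p) × ℤˣ)), IsNoisyVersion η (cleanLaw ν U μ) P →
      ∀ (Ω : Type*) [MeasurableSpace Ω] (Pr : Measure Ω) [IsProbabilityMeasure Pr]
        (S : Fin n → Ω → EuclideanSpace ℝ (Fin p) × ℤˣ),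
        (∀ k, HasLaw (S k) P Pr) → iIndepFun S Pr →
      ∀ (δ : ℝ), 0 < δ →
        1 - δ ≤ Pr.real {ω | topSingularValue (dataMatrix fun k => S k ω) ≤
          Real.sqrt p * (c₅ + c₆ * Real.sqrt n / p * ∑ i, |μ i| + 2 * n * ‖μ‖ ^ 2 / p
            + (c₇ + c₈ * (⨆ i, |μ i|) * Real.sqrt n) / p
              * (n * Real.log 9 + Real.log (4 / δ)) ^ (2 / α))} := by
  obtain ⟨a, b, ha, hb, hab⟩ := exists_forall_measure_exists_sum_sq_gt_le hα hα2
  -- The `2` in `a + 2` comes from two applications of AM–GM. The terms with `c₆` and `c₈` are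
  -- nonnegative slack, so `1` serves.
  refine ⟨a + 2, 1, b, 1, by linarith, one_pos, hb, one_pos, ?_⟩
  intro n p hn hp κ _ ν hν U hU μ η _ _ P hP Ω _ Pr _ S hS hind δ hδ
  rcases le_or_gt 1 δ with hδ1 | hδ1
  · exact (sub_nonpos.2 hδ1).trans measureReal_nonneg
  have := hν.isProbabilityMeasure
  have hp0 : (0 : ℝ) < p := by exact_mod_cast hp
  have hn1 : (1 : ℝ) ≤ n := by exact_mod_cast hn
  have : Nonempty (Fin p) := ⟨⟨0, hp⟩⟩
  set L := n * Real.log 9 + Real.log (4 / δ) with hL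
  have hlog4 : 0 ≤ Real.log (4 / δ) := Real.log_nonneg (by rw [le_div_iff₀ hδ]; linarith)
  have hlog9 : 1 ≤ Real.log 9 := by
    rw [Real.le_log_iff_exp_le (by norm_num)]
    linarith [Real.exp_one_lt_d9]
  -- This yields both `1 ≤ L` and `n * exp (-L) ≤ 1`.
  have hnL : n ≤ L := by nlinarith
  have hcard : (Fintype.card (Fin n) : ℝ) * Real.exp (-L) ≤ 1 := by
    rw [Fintype.card_fin, Real.exp_neg, ← div_eq_mul_inv, div_le_one (Real.exp_pos _)]
    linarith [Real.add_one_le_exp L]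
  obtain ⟨N, hNcard, hN1, hNnet⟩ := exists_finset_half_net (EuclideanSpace ℝ (Fin n))
  rw [finrank_euclideanSpace, Fintype.card_fin] at hNcard
  classical
  set t := a * p + b * L ^ (2 / α) with ht
  have hL0 : 0 ≤ L ^ (2 / α) := Real.rpow_nonneg (by linarith) _
  have ht0 : 0 ≤ t := by positivity
  set T := Real.sqrt t + Real.sqrt n * ‖μ‖ with hT
  have hbad : Pr {ω | ∃ v ∈ N, T < ‖∑ k, v k • (S k ω).1‖} ≤ ENNReal.ofReal δ := by
    refine (measure_exists_norm_gt_le hν.isProbabilityMeasure hU μ hP.map_fst hS hind hN1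
      t).trans ?_
    have h := hab ν (fun j => isCenteredSubWeibull_of_orliczNorm_le_one hα hα2 (hν.mean_zero j)
      (hν.orlicz_le j)) (N.image fun v => WithLp.ofLp v)
      (fun w hw => by
        obtain ⟨v, hv, rfl⟩ := Finset.mem_image.1 hw
        rw [← EuclideanSpace.real_norm_sq_eq]
        exact pow_le_one₀ (norm_nonneg _) (hN1 v hv)) L (by linarith) hcard
    simp only [Fintype.card_fin, Finset.exists_mem_image] at h
    refine h.trans (ENNReal.ofReal_le_ofReal ?_)
    exact net_failure_prob_le (Finset.card_image_le.trans hNcard) hδ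
  have hcover : Set.univ ⊆ {ω | topSingularValue (dataMatrix fun k => S k ω) ≤ 2 * T} ∪
      {ω | ∃ v ∈ N, T < ‖∑ k, v k • (S k ω).1‖} := by
    intro ω _
    by_cases hω : ∃ v ∈ N, T < ‖∑ k, v k • (S k ω).1‖
    · exact Or.inr hω
    · push Not at hω
      exact Or.inl (topSingularValue_dataMatrix_le _ hNnet (by positivity) hω)
  have hprob : 1 - δ ≤ Pr.real {ω | topSingularValue (dataMatrix fun k => S k ω) ≤ 2 * T} := by
    have h1 := (measureReal_mono hcover).trans (measureReal_union_le (μ := Pr) _ _)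
    have h2 : Pr.real {ω | ∃ v ∈ N, T < ‖∑ k, v k • (S k ω).1‖} ≤ δ :=
      ENNReal.toReal_le_of_le_ofReal hδ.le hbad
    rw [probReal_univ] at h1
    linarith
  refine hprob.trans (measureReal_mono ?_)
  intro ω hω
  rw [Set.mem_ofPred_eq] at hω ⊢
  refine hω.trans ?_
  have h1 := two_mul_le_sqrt_mul_one_add_div hp0 (Real.sq_sqrt ht0).le
  have h2 := two_mul_le_sqrt_mul_one_add_div (a := Real.sqrt n * ‖μ‖) (x := n * ‖μ‖ ^ 2) hp0
    (by rw [mul_pow, Real.sq_sqrt (by positivity)])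
  have h3 : t / p = a + b / p * L ^ (2 / α) := by rw [ht]; field_simp
  have hsup : 0 ≤ ⨆ i, |μ i| := Real.iSup_nonneg fun i => abs_nonneg _
  have h4 : 0 ≤ 1 * Real.sqrt n / p * ∑ i, |μ i| :=
    mul_nonneg (by positivity) (Finset.sum_nonneg fun i _ => abs_nonneg _)
  have h5 : 0 ≤ n * ‖μ‖ ^ 2 / p := by positivity
  have h6 : b / p * L ^ (2 / α) ≤ (b + 1 * (⨆ i, |μ i|) * Real.sqrt n) / p * L ^ (2 / α) := by
    gcongr
    have := mul_nonneg hsup (Real.sqrt_nonneg n)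
    linarith
  calc 2 * T = 2 * Real.sqrt t + 2 * (Real.sqrt n * ‖μ‖) := by rw [hT]; ring
    _ ≤ Real.sqrt p * (1 + t / p) + Real.sqrt p * (1 + n * ‖μ‖ ^ 2 / p) := add_le_add h1 h2
    _ = Real.sqrt p * (a + 2 + n * ‖μ‖ ^ 2 / p + b / p * L ^ (2 / α)) := by rw [h3]; ring
    _ ≤ _ := by
        refine mul_le_mul_of_nonneg_left ?_ (Real.sqrt_nonneg _)
        -- AM–GM uses only one of these two copies; the other is slack.
        have e : 2 * (n : ℝ) * ‖μ‖ ^ 2 / p = n * ‖μ‖ ^ 2 / p + n * ‖μ‖ ^ 2 / p := by ring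
        rw [e]
        linarith
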